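/- Let $L\ge 3$ be odd and consider the $L\times L\times L$ Rubik's cube with its $6L^2$ facelet locations; put $n=(L-3)/2$. A \emph{slice-rotation} is one of the $6(L-1)$ quarter turns (in either direction) of a layer orthogonal to a coordinate axis, the three middle layers excluded, so that the six face centres stay fixed. Slice-rotations are permutations of the facelet locations, and $\mathbf G_L$ is the group they generate. Apart from the fixed centres, the cubelets fall into the following subsystems: the 8 corners; the 12 central edges; for each $k\in\{1,\dots,n\}$, the 24 wing edges and the 24 $+$-centres at distance $k$ from a middle layer; and for each $i,j\in\{1,\dots,n\}$, the 24 centre pieces at distances $i$ and $j$ from two middle layers, taken in this cyclic order (X-centres if $i=j$, oblique centres if $i\ne j$). Fix a convention for measuring the orientations of corners and central edges, that is, a reference facelet on each of their positions; corner orientations are counted anti-clockwise. The facelets of the wing edges are numbered in a way that is invariant under all rotations of space. A \emph{configuration} consists of a permutation of the cubelets of each subsystem, namely $\sigma\in S_8$ (corners), $\tau\in S_{12}$ (central edges), $\theta_k,\eta_k,\omega_{ij}\in S_{24}$ (wing edges, $+$-centres, centre pieces), and of orientations $x_p\in\mathbb Z/3$ of the corners, $z_p\in\mathbb Z/2$ of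 the central edges and $y_p(k)\in\mathbb Z/2$ of the wing edges. Every configuration stands for a permutation of the facelet locations that fixes the six face centres. It satisfies the \emph{First Law of Cubology} if $$\operatorname{sgn}\sigma=\operatorname{sgn}\tau=\operatorname{sgn}\omega_{ii},\qquad \operatorname{sgn}\eta_k=\operatorname{sgn}\sigma\,\operatorname{sgn}\theta_k,\qquad \operatorname{sgn}\omega_{ij}=\operatorname{sgn}\sigma\,\operatorname{sgn}\theta_i\,\operatorname{sgn}\theta_j\ (i\neq j),$$ $$\sum_p x_p=0\in\mathbb Z/3,\qquad \sum_p z_p=0\in\mathbb Z/2,\qquad y_p(k)=0\ \text{ for all } p,k.$$ The \emph{swap-moves} are the facelet permutations given by the following configurations: (1) 3-cycles: a 3-cycle of the cubelets of one subsystem, all other cubelets keeping their positions, and all orientations being $0$; (2) opposite twists: all positions are kept, one corner is rotated by $+1$ and another corner by $-1$, or the same for two central edges; (3) coupled 2-cycles: a transposition in each subsystem of some nonempty family of subsystems, all orientations being $0$, the family being such that the First Law is satisfied. Then, for every orientation convention: (a) The group generated by the swap-moves is exactly $\mathbf G_L$. (b) From the solved colouring of the cube, and likewise from every other initial colouring of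 the facelets with six colours, finite sequences of swap-moves reach exactly the same colourings as finite sequences of slice-rotations. (c) All configurations of the classes (1)–(3) satisfy the First Law. (d) Every element of $\mathbf G_L$ is given by exactly one configuration, and a configuration gives an element of $\mathbf G_L$ if and only if it satisfies the First Law. (e) Every configuration $c$ that satisfies the First Law is built in three steps. Its facelet permutation is $g_3g_2g_1$, where $g_1$ is the identity or a single coupled 2-cycle move and is given by a configuration with the same sign as $c$ in every subsystem; $g_2$ is a product of 3-cycle moves, and $g_2g_1$ is given by a configuration with the same cubelet permutations as $c$; and $g_3$ is a product of opposite twists. -/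

import Mathlib

/-! # The odd `L × L × L` Rubik's cube

Sub-cubes sit at the points of `{-r, …, r}³`, where `r = (L - 1) / 2` and `L` is odd. -/

namespace RubikCube

/-- Positions of sub-cubes: integer vectors, the centre of the cube being the origin. -/
abbrev Vec := Fin 3 → ℤ

/-- The coordinate `r = (L - 1) / 2` of the outermost layers (for odd `L`). -/
def rad (L : ℕ) : ℤ := ((L / 2 : ℕ) : ℤ)

/-- The product of the three coordinates; its sign records on which side of the mirror a
position lies. -/
def chir (p : Vec) : ℤ := p 0 * p 1 * p 2

/-- The quarter turn of space about the axis `b`. -/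
def turn (b : Fin 3) (p : Vec) : Vec :=
  fun i => if i = b then p b else if i = b + 1 then -p (b + 2) else p (b + 1)

/-- The inverse quarter turn of space about the axis `b`. -/
def turnInv (b : Fin 3) (p : Vec) : Vec :=
  fun i => if i = b then p b else if i = b + 1 then p (b + 2) else -p (b + 1)

/-- What a quarter turn about the axis `b` does to (unsigned) coordinate axes. -/
def turnAxis (b : Fin 3) (a : Fin 3) : Fin 3 := Equiv.swap (b + 1) (b + 2) a

/-- A facelet location: a sub-cube at `pos` together with an axis in whose direction this
sub-cube has an outer face. There are `6 L²` of these when `L ≥ 3` is odd. -/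
@[ext]
structure Facelet (L : ℕ) where
  pos : Vec
  axis : Fin 3
  bound : ∀ i, |pos i| ≤ rad L
  outer : |pos axis| = rad L

theorem turn_at (b : Fin 3) (p : Vec) : turn b p b = p b := by simp [turn]

theorem turnInv_at (b : Fin 3) (p : Vec) : turnInv b p b = p b := by simp [turnInv]

theorem turnInv_turn (b : Fin 3) (p : Vec) : turnInv b (turn b p) = p := by
  funext i; fin_cases b <;> fin_cases i <;> simp [turn, turnInv]

theorem turn_turnInv (b : Fin 3) (p : Vec) : turn b (turnInv b p) = p := by
  funext i; fin_cases b <;> fin_cases i <;> simp [turn, turnInv]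

theorem turnAxis_turnAxis (b a : Fin 3) : turnAxis b (turnAxis b a) = a := by
  simp [turnAxis]

theorem abs_turn (b : Fin 3) (p : Vec) (a : Fin 3) : |turn b p (turnAxis b a)| = |p a| := by
  fin_cases b <;> fin_cases a <;> simp [turn, turnAxis, Equiv.swap_apply_def]

theorem abs_turnInv (b : Fin 3) (p : Vec) (a : Fin 3) :
    |turnInv b p (turnAxis b a)| = |p a| := by
  fin_cases b <;> fin_cases a <;> simp [turnInv, turnAxis, Equiv.swap_apply_def]

/-- The facelet `f` carried along by a quarter turn about the axis `b`. -/
def Facelet.turn {L : ℕ} (b : Fin 3) (f : Facelet L) : Facelet L where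
  pos := RubikCube.turn b f.pos
  axis := turnAxis b f.axis
  bound i := by
    rw [← turnAxis_turnAxis b i, abs_turn]; exact f.bound _
  outer := by rw [abs_turn]; exact f.outer

/-- The facelet `f` carried along by an inverse quarter turn about the axis `b`. -/
def Facelet.turnInv {L : ℕ} (b : Fin 3) (f : Facelet L) : Facelet L where
  pos := RubikCube.turnInv b f.pos
  axis := turnAxis b f.axis
  bound i := by
    rw [← turnAxis_turnAxis b i, abs_turnInv]; exact f.bound _
  outer := by rw [abs_turnInv]; exact f.outer

/-- The quarter turn of the layer `{p | p b = c}`, as a permutation of the facelet locations. -/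
def slice (L : ℕ) (b : Fin 3) (c : ℤ) : Equiv.Perm (Facelet L) where
  toFun f := if f.pos b = c then f.turn b else f
  invFun f := if f.pos b = c then f.turnInv b else f
  left_inv f := by
    by_cases h : f.pos b = c
    · have h' : (f.turn b).pos b = c := by simp [Facelet.turn, turn_at, h]
      simp only [h, if_true, h']
      ext1
      · exact turnInv_turn b f.pos
      · exact turnAxis_turnAxis b f.axis
    · simp [h]
  right_inv f := by
    by_cases h : f.pos b = c
    · have h' : (f.turnInv b).pos b = c := by simp [Facelet.turnInv, turnInv_at, h]
      simp only [h, if_true, h']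
      ext1
      · exact turn_turnInv b f.pos
      · exact turnAxis_turnAxis b f.axis
    · simp [h]

/-- The `6 (L - 1)` slice-rotations: quarter turns, in both directions, of the layers other than
the three middle ones (so that the six face centres stay fixed). -/
def sliceRotations (L : ℕ) : Set (Equiv.Perm (Facelet L)) :=
  {g | ∃ (b : Fin 3) (c : ℤ), c ≠ 0 ∧ |c| ≤ rad L ∧ (g = slice L b c ∨ g = (slice L b c)⁻¹)}

/-- The slice-rotation group `G_L`. -/
def sliceGroup (L : ℕ) : Subgroup (Equiv.Perm (Facelet L)) :=
  Subgroup.closure (sliceRotations L)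

/-! ### Independent cubelet subsystems -/

/-- Names of the independent cubelet subsystems. The index `k : Fin ((L - 3) / 2)` stands for the
layers at distance `k + 1` from the middle layers. The subsystem `center i i` consists of
X-centres, and `center i j` with `i ≠ j` of oblique centres. -/
inductive Subsystem (L : ℕ) : Type
  | corner : Subsystem L
  | edge : Subsystem L
  | wing (k : Fin ((L - 3) / 2)) : Subsystem L
  | plus (k : Fin ((L - 3) / 2)) : Subsystem L
  | center (i j : Fin ((L - 3) / 2)) : Subsystem L

/-- The positions that make up a subsystem. The subsystems `center i j` and `center j i` are
mirror images of each other. -/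
def Subsystem.Mem {L : ℕ} : Subsystem L → Vec → Prop
  | .corner, p => ∀ a, |p a| = rad L
  | .edge, p => ∃ a, p a = 0 ∧ |p (a + 1)| = rad L ∧ |p (a + 2)| = rad L ∧ 0 < rad L
  | .wing k, p => ∃ a, |p a| = (k : ℕ) + 1 ∧ |p (a + 1)| = rad L ∧ |p (a + 2)| = rad L
  | .plus k, p => ∃ a, |p a| = rad L ∧
      ((|p (a + 1)| = (k : ℕ) + 1 ∧ p (a + 2) = 0) ∨ (p (a + 1) = 0 ∧ |p (a + 2)| = (k : ℕ) + 1))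
  | .center i j, p => ∃ a, |p a| = rad L ∧
      ((0 < chir p ∧ |p (a + 1)| = (i : ℕ) + 1 ∧ |p (a + 2)| = (j : ℕ) + 1) ∨
       (chir p < 0 ∧ |p (a + 1)| = (j : ℕ) + 1 ∧ |p (a + 2)| = (i : ℕ) + 1))

/-- The cubelets of a subsystem, named by their positions in the solved cube. -/
abbrev Subsystem.Cubelet {L : ℕ} (X : Subsystem L) : Type := {p : Vec // X.Mem p}

/-- The number of facelets of each cubelet of a subsystem, which is also the number of its
orientations. -/
def Subsystem.modulus {L : ℕ} : Subsystem L → ℕ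
  | .corner => 3
  | .edge => 2
  | .wing _ => 2
  | .plus _ => 1
  | .center _ _ => 1

theorem index_lt {L : ℕ} (k : Fin ((L - 3) / 2)) : ((k : ℕ) : ℤ) + 1 < rad L := by
  have := k.2
  unfold rad
  omega

theorem Subsystem.Mem.bound {L : ℕ} {X : Subsystem L} {p : Vec} (h : X.Mem p) (i : Fin 3) :
    |p i| ≤ rad L := by
  cases X with
  | corner => exact (h i).le
  | edge =>
    obtain ⟨a, h1, h2, h3, h4⟩ := h
    fin_cases a <;> fin_cases i <;> simp_all <;> omega
  | wing k =>
    have hk := index_lt k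
    obtain ⟨a, h1, h2, h3⟩ := h
    fin_cases a <;> fin_cases i <;> simp_all <;> omega
  | plus k =>
    have hk := index_lt k
    obtain ⟨a, h1, ⟨h2, h3⟩ | ⟨h2, h3⟩⟩ := h <;>
      fin_cases a <;> fin_cases i <;> simp_all <;> omega
  | center k l =>
    have hk := index_lt k
    have hl := index_lt l
    obtain ⟨a, h1, h2⟩ := h
    fin_cases a <;> fin_cases i <;> simp at h1 h2 ⊢ <;> omega

/-- Distinct subsystems have no position in common. -/
theorem Subsystem.Mem.unique {L : ℕ} {X Y : Subsystem L} {p : Vec} (hX : X.Mem p)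
    (hY : Y.Mem p) : X = Y := by
  have hi := fun k : Fin ((L - 3) / 2) => index_lt k
  have h0 : ∀ a, p a = 0 ↔ |p a| = 0 := fun a => abs_eq_zero.symm
  cases X <;> cases Y <;> simp only [Subsystem.Mem, h0, Fin.forall_fin_succ, Fin.exists_fin_succ,
    IsEmpty.forall_iff, IsEmpty.exists_iff, Fin.succ_zero_eq_one, Fin.succ_one_eq_two, zero_add,
    and_true, or_false, Fin.isValue, Fin.reduceAdd] at hX hY
  case corner.corner | edge.edge => rfl
  case wing.wing k l => obtain rfl : k = l := by ext; have := hi k; have := hi l; omega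
                        rfl
  case plus.plus k l => obtain rfl : k = l := by ext; have := hi k; have := hi l; omega
                        rfl
  case center.center i j k l =>
    have := hi i
    have := hi j
    have := hi k
    have := hi l
    obtain rfl : i = k := by ext; omega
    obtain rfl : j = l := by ext; omega
    rfl
  all_goals exfalso
  all_goals first
    | omega
    | (rename_i k; have := hi k; omega)
    | (rename_i k l; have := hi k; have := hi l; omega)
    | (rename_i j k l; have := hi j; have := hi k; have := hi l; omega)

instance {L : ℕ} (X : Subsystem L) : Finite X.Cubelet := by
  have : Set.Finite {p : Vec | X.Mem p} := by
    refine (Set.finite_Icc (fun _ => -rad L : Vec) (fun _ => rad L)).subset ?_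
    intro p hp
    exact ⟨fun i => (abs_le.mp (hp.bound i)).1, fun i => (abs_le.mp (hp.bound i)).2⟩
  exact this.to_subtype

noncomputable instance {L : ℕ} (X : Subsystem L) : Fintype X.Cubelet := Fintype.ofFinite _

/-! ### Permutations and orientations -/

/-- The axis of the coordinate of a (central or wing) edge that is not extremal. -/
def innerAxis (L : ℕ) (p : Vec) : Fin 3 :=
  if |p 0| ≠ rad L then 0 else if |p 1| ≠ rad L then 1 else 2

/-- The axis of the extremal coordinate of a centre piece. -/
def outerAxis (L : ℕ) (p : Vec) : Fin 3 :=
  if |p 0| = rad L then 0 else if |p 1| = rad L then 1 else 2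

/-- A convention for measuring orientations: a reference facelet on each corner position (given
by its axis) and on each central edge position (of its two facelets, `0` picks the one whose axis
follows the inner axis in cyclic order, and `1` the other one). -/
structure Marking where
  corner : Vec → Fin 3
  edge : Vec → ZMod 2

/-- The axis of the facelet number `t` of the position `p` of the subsystem `X`. The facelets of
a corner are counted anti-clockwise, seen from outside, from its reference facelet, and the facelets
of a central edge from its reference facelet. The facelets of the wing edges are numbered so that
the numbering is invariant under all rotations of space. -/
def Subsystem.axis {L : ℕ} (μ : Marking) : (X : Subsystem L) → Vec → ZMod X.modulus → Fin 3
  | .corner, p, t =>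
      let s : Fin 3 := t
      if 0 < chir p then μ.corner p + s else μ.corner p - s
  | .edge, p, t =>
      let s : ZMod 2 := t
      if μ.edge p + s = 0 then innerAxis L p + 1 else innerAxis L p + 2
  | .wing _, p, t =>
      let s : ZMod 2 := t
      if s = 0 ↔ 0 < chir p then innerAxis L p + 1 else innerAxis L p + 2
  | .plus _, p, _ => outerAxis L p
  | .center _ _, p, _ => outerAxis L p

theorem Subsystem.axis_outer {L : ℕ} (μ : Marking) (X : Subsystem L) {p : Vec} (h : X.Mem p)
    (t : ZMod X.modulus) : |p (X.axis μ p t)| = rad L := by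
  cases X with
  | corner => exact h _
  | edge =>
    obtain ⟨a, h1, h2, h3, h4⟩ := h
    simp only [Subsystem.axis, innerAxis]
    fin_cases a <;> simp at h1 h2 h3 <;> split_ifs <;> simp_all
  | wing k =>
    have hk := index_lt k
    obtain ⟨a, h1, h2, h3⟩ := h
    simp only [Subsystem.axis, innerAxis]
    fin_cases a <;> simp at h1 h2 h3 <;> split_ifs <;> simp_all
  | plus k =>
    obtain ⟨a, h1, -⟩ := h
    simp only [Subsystem.axis, outerAxis]
    fin_cases a <;> simp at h1 <;> split_ifs <;> simp_all
  | center k l =>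
    obtain ⟨a, h1, -⟩ := h
    simp only [Subsystem.axis, outerAxis]
    fin_cases a <;> simp at h1 <;> split_ifs <;> simp_all

theorem Subsystem.axis_injective {L : ℕ} (μ : Marking) (X : Subsystem L) (p : Vec) :
    Function.Injective (X.axis μ p) := by
  have key : ∀ a : Fin 3, a + 1 ≠ a + 2 := by decide
  have two : ∀ s t u : ZMod 2, (u + s = 0 ↔ u + t = 0) → s = t := by decide
  have zero : ∀ s t : ZMod 2, (s = 0 ↔ t = 0) → s = t := by decide
  cases X with
  | corner =>
    intro s t h
    simp only [Subsystem.axis] at h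
    split_ifs at h
    · exact add_left_cancel (G := Fin 3) h
    · exact sub_right_injective (G := Fin 3) h
  | edge =>
    intro s t h
    simp only [Subsystem.axis] at h
    refine two s t (μ.edge p) ?_
    split_ifs at h <;> simp_all
  | wing k =>
    intro s t h
    simp only [Subsystem.axis] at h
    have h0 : ((s : ZMod 2) = 0 ↔ (t : ZMod 2) = 0) := by
      split_ifs at h <;> simp_all <;> tauto
    exact zero s t h0
  | plus k => intro s t _; exact Subsingleton.elim (α := ZMod 1) s t
  | center k l => intro s t _; exact Subsingleton.elim (α := ZMod 1) s t

/-- All numbered facelets of all cubelets of all subsystems. -/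
abbrev Slot (L : ℕ) : Type := Σ X : Subsystem L, X.Cubelet × ZMod X.modulus

/-- The facelet location with a given subsystem, position and number. Every facelet location other
than the six fixed centres is of this form. -/
def faceletAt {L : ℕ} (μ : Marking) : Slot L ↪ Facelet L where
  toFun s :=
    { pos := s.2.1.1
      axis := s.1.axis μ s.2.1.1 s.2.2
      bound := s.2.1.2.bound
      outer := s.1.axis_outer μ s.2.1.2 s.2.2 }
  inj' := by
    rintro ⟨X, ⟨p, hp⟩, t⟩ ⟨Y, ⟨q, hq⟩, s⟩ h
    simp only [Facelet.mk.injEq] at h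
    obtain ⟨rfl, h⟩ := h
    obtain rfl := hp.unique hq
    rw [X.axis_injective μ p h]

/-- A configuration of the cube, described by cubelet permutations and cubelet orientations:
the cubelet `p` of the subsystem `X` has been moved to the position `perm X p` and has the
orientation `ori X p`. Arbitrary values are allowed here. -/
@[ext]
structure Config (L : ℕ) where
  perm : ∀ X : Subsystem L, Equiv.Perm X.Cubelet
  ori : ∀ X : Subsystem L, X.Cubelet → ZMod X.modulus

/-- The action of a configuration on numbered facelets. -/
def Config.slotPerm {L : ℕ} (c : Config L) : Equiv.Perm (Slot L) where
  toFun s := ⟨s.1, c.perm s.1 s.2.1, s.2.2 + c.ori s.1 s.2.1⟩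
  invFun s := ⟨s.1, (c.perm s.1).symm s.2.1, s.2.2 - c.ori s.1 ((c.perm s.1).symm s.2.1)⟩
  left_inv s := by simp
  right_inv s := by simp

/-- The permutation of facelet locations that a configuration stands for; it fixes the six face
centres. -/
noncomputable def Config.realize {L : ℕ} (μ : Marking) (c : Config L) : Equiv.Perm (Facelet L) :=
  c.slotPerm.viaEmbedding (faceletAt μ)

/-- The sign of the cubelet permutation in the subsystem `X`. -/
noncomputable def Config.sgn {L : ℕ} (c : Config L) (X : Subsystem L) : ℤˣ :=
  Equiv.Perm.sign (c.perm X)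

/-- The constraints of the First Law of Cubology. -/
structure Config.FirstLaw {L : ℕ} (c : Config L) : Prop where
  sgn_edge : c.sgn .corner = c.sgn .edge
  sgn_xCenter : ∀ i, c.sgn .corner = c.sgn (.center i i)
  sgn_plus : ∀ k, c.sgn (.plus k) = c.sgn .corner * c.sgn (.wing k)
  sgn_oblique : ∀ i j, i ≠ j →
    c.sgn (.center i j) = c.sgn .corner * c.sgn (.wing i) * c.sgn (.wing j)
  sum_corner : ∑ p, c.ori .corner p = 0
  sum_edge : ∑ p, c.ori .edge p = 0
  ori_wing : ∀ k p, c.ori (.wing k) p = 0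

/-! ### Swap-moves -/

/-- Class 1: a 3-cycle within one subsystem, preserving all orientations. -/
def Config.IsThreeCycle {L : ℕ} (c : Config L) : Prop :=
  c.ori = 0 ∧ ∃ X, (c.perm X).IsThreeCycle ∧ ∀ Y, Y ≠ X → c.perm Y = 1

/-- Class 2: all positions are kept, and two corners, or two central edges, are rotated by one unit
in opposite directions. -/
def Config.IsOppositeTwist {L : ℕ} (c : Config L) : Prop :=
  c.perm = 1 ∧ ∃ X, (X = .corner ∨ X = .edge) ∧
    (∃ p q : X.Cubelet, p ≠ q ∧ c.ori X = Pi.single p 1 - Pi.single q 1) ∧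
    ∀ Y, Y ≠ X → c.ori Y = 0

/-- Class 3: a 2-cycle in each subsystem of some nonempty family, preserving all orientations, the
family being such that the constraints are respected. -/
def Config.IsCoupledTwoCycle {L : ℕ} (c : Config L) : Prop :=
  c.ori = 0 ∧ c.FirstLaw ∧
    ∃ S : Set (Subsystem L), S.Nonempty ∧ (∀ X ∈ S, (c.perm X).IsSwap) ∧ ∀ X ∉ S, c.perm X = 1

/-- The facelet permutations of class 1. -/
def threeCycles (L : ℕ) (μ : Marking) : Set (Equiv.Perm (Facelet L)) :=
  Config.realize μ '' {c | c.IsThreeCycle}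

/-- The facelet permutations of class 2. -/
def oppositeTwists (L : ℕ) (μ : Marking) : Set (Equiv.Perm (Facelet L)) :=
  Config.realize μ '' {c | c.IsOppositeTwist}

/-- The facelet permutations of class 3. -/
def coupledTwoCycles (L : ℕ) (μ : Marking) : Set (Equiv.Perm (Facelet L)) :=
  Config.realize μ '' {c | c.IsCoupledTwoCycle}

/-- All swap-moves. -/
def swapMoves (L : ℕ) (μ : Marking) : Set (Equiv.Perm (Facelet L)) :=
  threeCycles L μ ∪ oppositeTwists L μ ∪ coupledTwoCycles L μ

/-! ### Colourings -/

/-- A colouring of the facelet locations with six colours. -/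
abbrev Colouring (L : ℕ) : Type := Facelet L → Fin 3 × Bool

/-- The solved cube: every face has its own colour. -/
def solved (L : ℕ) : Colouring L := fun f => (f.axis, decide (0 < f.pos f.axis))

/-- The colourings that finite sequences of moves from `M` produce from the colouring `s`.
The move `g` carries the colour at the location `f` to the location `g f`. -/
def reachable {L : ℕ} (M : Set (Equiv.Perm (Facelet L))) (s : Colouring L) : Set (Colouring L) :=
  {s' | Relation.ReflTransGen (fun u v => ∃ g ∈ M, v = u ∘ ⇑g⁻¹) s s'}

end RubikCube

/-! Configurations form a group: a product, over the subsystems, of wreath products of a cyclic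
orientation group by a symmetric group. It embeds into the facelet permutations, and the core of the
theorem is that the preimage of `sliceGroup L` is the subgroup cut out by the First Law.

Necessity is checked on generators. A quarter turn of a layer is a union of 4-cycles in each
subsystem, so its sign is the parity of the number of positions in a quarter of the layer
(`sign_cubeletSlice`, `ncard_quarter`). The orientation changes are differences of a potential
(`turnAxis_axis`), so they sum to zero.

Sufficiency rests on commutators. If two permutations move only one common cubelet, their commutator
is a 3-cycle. Applied to a slice and a conjugate of a parallel slice, this yields enough 3-cycles to
connect all cubelets of a subsystem (`linked_turn`), and Jordan's theorem on primitive groups then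
gives all even permutations (`alternatingGroup_le_localPerms`). The slice may be a middle one: it
normalizes the group, so the commutator still belongs to it. These 3-cycles disturb no other
subsystem, but they leave orientations in their own subsystem uncontrolled. To correct these, a
configuration that twists a cubelet in place is commuted with a 3-cycle; the result is a pure
orientation change, from which all opposite twists follow (`single_sub_single_mem`).

Slices realize any prescribed signs on corners and wings (`exists_sliceConfig_sgn`), and the First
Law determines all other signs from these. Dividing by a suitable product of slices makes all signs
trivial, and 3-cycles and twists do the rest; coupled 2-cycles need no explicit construction.
Conversely, `Config.FirstLaw.three_steps` writes every lawful configuration in swap-moves. So the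
two groups agree, and since both sets of moves are closed under inversion, the reachable colourings
are the orbits of this common group. -/

namespace RubikCube

open Equiv

/-! ### The group of configurations -/

namespace Config

variable {L : ℕ}

/-- The right factor acts first: a cubelet collects the twist from `d`, then the twist that `c`
applies at the position where `d` has put it. -/
instance : Mul (Config L) where
  mul c d :=
    { perm := fun X => c.perm X * d.perm X
      ori := fun X p => d.ori X p + c.ori X (d.perm X p) }

instance : One (Config L) where
  one := { perm := fun _ => 1, ori := fun _ _ => 0 }

instance : Inv (Config L) where
  inv c :=
    { perm := fun X => (c.perm X)⁻¹
      ori := fun X p => -c.ori X ((c.perm X)⁻¹ p) }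

theorem mul_perm (c d : Config L) (X : Subsystem L) : (c * d).perm X = c.perm X * d.perm X := rfl

theorem mul_ori (c d : Config L) (X : Subsystem L) (p : X.Cubelet) :
    (c * d).ori X p = d.ori X p + c.ori X (d.perm X p) := rfl

theorem one_perm (X : Subsystem L) : (1 : Config L).perm X = 1 := rfl

theorem one_ori (X : Subsystem L) (p : X.Cubelet) : (1 : Config L).ori X p = 0 := rfl

theorem inv_perm (c : Config L) (X : Subsystem L) : c⁻¹.perm X = (c.perm X)⁻¹ := rfl

theorem inv_ori (c : Config L) (X : Subsystem L) (p : X.Cubelet) :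
    c⁻¹.ori X p = -c.ori X ((c.perm X)⁻¹ p) := rfl

instance : Group (Config L) :=
  Group.ofLeftAxioms
    (by
      intro a b c
      ext X p
      · simp [mul_perm]
      · simp [mul_ori, mul_perm, add_assoc])
    (by
      intro a
      ext X p
      · simp [mul_perm, one_perm]
      · simp [mul_ori, one_ori])
    (by
      intro a
      ext X p
      · simp [mul_perm, one_perm, inv_perm]
      · simp [mul_ori, one_ori, inv_ori])

theorem slotPerm_apply (c : Config L) (X : Subsystem L) (p : X.Cubelet) (t : ZMod X.modulus) :
    c.slotPerm ⟨X, p, t⟩ = ⟨X, c.perm X p, t + c.ori X p⟩ := rfl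

/-- The action on numbered facelets, as a group homomorphism. -/
def slotHom (L : ℕ) : Config L →* Perm (Slot L) where
  toFun := slotPerm
  map_one' := by
    ext1 ⟨X, p, t⟩
    simp [slotPerm_apply, one_perm, one_ori]
  map_mul' c d := by
    ext1 ⟨X, p, t⟩
    simp [slotPerm_apply, mul_perm, mul_ori, add_assoc]

/-- Facelet number 0 of a cubelet already shows where the cubelet goes and how it is twisted. -/
theorem slotPerm_injective : Function.Injective (slotPerm (L := L)) := by
  intro c d h
  have key : ∀ X p, c.perm X p = d.perm X p ∧ c.ori X p = d.ori X p := by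
    intro X p
    have := DFunLike.congr_fun h ⟨X, p, 0⟩
    simpa [slotPerm_apply] using this
  ext X p
  · rw [(key X p).1]
  · exact (key X p).2

/-- Configurations as facelet permutations. -/
noncomputable def realizeHom (μ : Marking) : Config L →* Perm (Facelet L) :=
  (Perm.viaEmbeddingHom (faceletAt μ)).comp (slotHom L)

theorem realizeHom_injective (μ : Marking) :
    Function.Injective (realizeHom μ : Config L →* Perm (Facelet L)) :=
  (Perm.viaEmbeddingHom_injective (faceletAt μ)).comp slotPerm_injective

theorem realize_faceletAt (μ : Marking) (c : Config L) (X : Subsystem L) (p : X.Cubelet)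
    (t : ZMod X.modulus) :
    c.realize μ (faceletAt μ ⟨X, p, t⟩) = faceletAt μ ⟨X, c.perm X p, t + c.ori X p⟩ :=
  Perm.viaEmbedding_apply _ _ _

theorem realize_eq_iff (μ : Marking) (c : Config L) (g : Perm (Facelet L)) :
    c.realize μ = g ↔
      (∀ (X : Subsystem L) (p : X.Cubelet) (t : ZMod X.modulus),
        g (faceletAt μ ⟨X, p, t⟩) = faceletAt μ ⟨X, c.perm X p, t + c.ori X p⟩) ∧
      ∀ f ∉ Set.range (faceletAt (L := L) μ), g f = f := by
  constructor
  · rintro rfl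
    exact ⟨realize_faceletAt μ c, fun f hf => Perm.viaEmbedding_apply_of_notMem _ _ _ hf⟩
  · rintro ⟨h1, h2⟩
    ext1 f
    by_cases hf : f ∈ Set.range (faceletAt (L := L) μ)
    · obtain ⟨⟨X, p, t⟩, rfl⟩ := hf
      rw [h1, realize_faceletAt]
    · rw [h2 f hf]
      exact Perm.viaEmbedding_apply_of_notMem _ _ _ hf

/-- The sign in a subsystem, as a group homomorphism. -/
noncomputable def sgnHom (X : Subsystem L) : Config L →* ℤˣ where
  toFun c := c.sgn X
  map_one' := by simp [sgn, one_perm]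
  map_mul' c d := by simp [sgn, mul_perm]

theorem sgn_mul (c d : Config L) (X : Subsystem L) : (c * d).sgn X = c.sgn X * d.sgn X :=
  map_mul (sgnHom X) c d

theorem sgn_inv (c : Config L) (X : Subsystem L) : c⁻¹.sgn X = c.sgn X := by
  rw [sgn, inv_perm, Perm.sign_inv]
  rfl

theorem sgn_one (X : Subsystem L) : (1 : Config L).sgn X = 1 := map_one (sgnHom X)

/-- Reindexing by the permutation of `d` removes the dependence on it: the total orientation is a
homomorphism, although single orientations are not. -/
theorem sum_ori_mul (c d : Config L) (X : Subsystem L) :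
    ∑ p, (c * d).ori X p = ∑ p, c.ori X p + ∑ p, d.ori X p := by
  simp only [mul_ori, Finset.sum_add_distrib]
  rw [Equiv.sum_comp (d.perm X) (c.ori X), add_comm]

theorem sum_ori_inv (c : Config L) (X : Subsystem L) :
    ∑ p, c⁻¹.ori X p = -∑ p, c.ori X p := by
  simp only [inv_ori, Finset.sum_neg_distrib]
  rw [Equiv.sum_comp (c.perm X)⁻¹ (c.ori X)]

/-- The configurations that satisfy the First Law form a group. -/
def firstLaw (L : ℕ) : Subgroup (Config L) where
  carrier := {c | c.FirstLaw}
  one_mem' := by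
    constructor <;> simp [sgn_one, one_ori]
  mul_mem' {c d} hc hd := by
    constructor
    · simp only [sgn_mul, hc.sgn_edge, hd.sgn_edge]
    · intro i
      simp only [sgn_mul, hc.sgn_xCenter i, hd.sgn_xCenter i]
    · intro k
      simp only [sgn_mul, hc.sgn_plus k, hd.sgn_plus k]
      exact mul_mul_mul_comm _ _ _ _
    · intro i j hij
      simp only [sgn_mul, hc.sgn_oblique i j hij, hd.sgn_oblique i j hij]
      rw [mul_mul_mul_comm, mul_mul_mul_comm (c.sgn .corner)]
    · rw [sum_ori_mul, hc.sum_corner, hd.sum_corner, add_zero]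
    · rw [sum_ori_mul, hc.sum_edge, hd.sum_edge, add_zero]
    · intro k p
      rw [mul_ori, hc.ori_wing, hd.ori_wing, add_zero]
  inv_mem' {c} hc := by
    constructor
    · simp only [sgn_inv, hc.sgn_edge]
    · intro i
      simp only [sgn_inv, hc.sgn_xCenter i]
    · intro k
      simp only [sgn_inv, hc.sgn_plus k]
    · intro i j hij
      simp only [sgn_inv, hc.sgn_oblique i j hij]
    · rw [sum_ori_inv, hc.sum_corner, neg_zero]
    · rw [sum_ori_inv, hc.sum_edge, neg_zero]
    · intro k p
      rw [inv_ori, hc.ori_wing, neg_zero]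

/-! ### Products of 3-cycles and of opposite twists -/

/-- Cubelet permutations, with all orientations zero. -/
def ofPerm (L : ℕ) : (∀ X : Subsystem L, Perm X.Cubelet) →* Config L where
  toFun π := ⟨π, 0⟩
  map_one' := rfl
  map_mul' π ρ := by
    ext X p
    · rfl
    · simp [mul_ori]

theorem ofPerm_perm (π : ∀ X : Subsystem L, Perm X.Cubelet) : (ofPerm L π).perm = π := rfl

/-- Cubelet orientations, with all positions kept. -/
def ofOri (L : ℕ) : Multiplicative (∀ X : Subsystem L, X.Cubelet → ZMod X.modulus) →* Config L where
  toFun v := ⟨1, v.toAdd⟩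
  map_one' := rfl
  map_mul' v w := by
    ext X p
    · rfl
    · simp [mul_ori, add_comm]

theorem eq_ofOri {c : Config L} (h : c.perm = 1) : c = ofOri L (.ofAdd c.ori) :=
  Config.ext h rfl

/-- Finiteness allows an element of the product over all subsystems to be split into factors
supported in one subsystem each. -/
instance : Finite (Subsystem L) := by
  let f : Subsystem L → Fin 5 × Option (Fin ((L - 3) / 2)) × Option (Fin ((L - 3) / 2))
    | .corner => (0, none, none)
    | .edge => (1, none, none)
    | .wing k => (2, some k, none)
    | .plus k => (3, some k, none)
    | .center i j => (4, some i, some j)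
  refine Finite.of_injective f ?_
  rintro (_ | _ | _ | _ | _) (_ | _ | _ | _ | _) h <;> simp_all [f]

/-- A subgroup that contains all 3-cycles contains all even cubelet permutations. -/
theorem ofPerm_mem_of_threeCycles {W : Subgroup (Config L)}
    (hW : ∀ c : Config L, c.IsThreeCycle → c ∈ W) (π : ∀ X : Subsystem L, Perm X.Cubelet)
    (hπ : ∀ X, Perm.sign (π X) = 1) : ofPerm L π ∈ W := by
  classical
  change π ∈ W.comap (ofPerm L)
  refine Subgroup.pi_mem_of_mulSingle_mem _ fun X => ?_
  change π X ∈ (W.comap (ofPerm L)).comap (MonoidHom.mulSingle (fun X => Perm X.Cubelet) X)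
  have h : π X ∈ alternatingGroup X.Cubelet := hπ X
  rw [← Perm.closure_three_cycles_eq_alternating] at h
  refine (Subgroup.closure_le _).2 ?_ h
  intro σ hσ
  refine hW _ ⟨rfl, X, ?_, ?_⟩
  · simpa [ofPerm_perm] using hσ
  · intro Y hY
    simp [ofPerm_perm, Pi.mulSingle_eq_of_ne hY]

/-- With a fixed point `q`, the vector `v` is the combination of the differences `e_p - e_q` with
coefficients `v p`; the multiples of `e_q` cancel because the coefficients sum to zero. -/
theorem single_sum_mem {ι : Type*} [Fintype ι] [DecidableEq ι] {m : ℕ}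
    (V : AddSubgroup (ι → ZMod m))
    (hV : ∀ p q : ι, p ≠ q → Pi.single p 1 - Pi.single q 1 ∈ V) (v : ι → ZMod m)
    (hv : ∑ p, v p = 0) : v ∈ V := by
  classical
  rcases isEmpty_or_nonempty ι with h | ⟨⟨q⟩⟩
  · rw [Subsingleton.elim v 0]; exact V.zero_mem
  have : v = ∑ p, v p • (Pi.single p 1 - Pi.single q 1 : ι → ZMod m) := by
    simp only [smul_sub, Finset.sum_sub_distrib, ← Finset.sum_smul, hv, zero_smul, sub_zero]
    funext i
    simp [Finset.sum_apply, Pi.single_apply]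
  rw [this]
  refine V.sum_mem fun p _ => ?_
  by_cases hpq : p = q
  · simp [hpq]
  -- An additive subgroup admits integer multiples only, so the coefficient is lifted to `ℤ`.
  · obtain ⟨n, hn⟩ := ZMod.intCast_surjective (v p)
    rw [← hn]
    have h1 := V.zsmul_mem (hV p q hpq) n
    convert h1 using 1
    funext i
    simp

/-- A subgroup that contains all opposite twists contains all configurations that satisfy the
First Law and keep all positions. -/
theorem mem_of_oppositeTwists {W : Subgroup (Config L)}
    (hW : ∀ c : Config L, c.IsOppositeTwist → c ∈ W) {c : Config L} (hc : c.FirstLaw)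
    (h1 : c.perm = 1) : c ∈ W := by
  classical
  rw [eq_ofOri h1]
  let V : AddSubgroup (∀ X : Subsystem L, X.Cubelet → ZMod X.modulus) :=
    Subgroup.toAddSubgroup' (W.comap (ofOri L))
  change c.ori ∈ V
  refine AddSubgroup.pi_mem_of_single_mem (H := V) c.ori fun X => ?_
  change c.ori X ∈ V.comap (AddMonoidHom.single (fun X : Subsystem L => X.Cubelet → ZMod X.modulus) X)
  have twist : (X = .corner ∨ X = .edge) → ∑ p, c.ori X p = 0 →
      c.ori X ∈ V.comap (AddMonoidHom.single
        (fun X : Subsystem L => X.Cubelet → ZMod X.modulus) X) := by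
    intro hX hsum
    refine single_sum_mem (ι := X.Cubelet) _ (fun p q hpq => ?_) _ hsum
    refine hW _ ⟨rfl, X, hX, ⟨p, q, hpq, ?_⟩, ?_⟩
    · exact Pi.single_eq_same (M := fun X : Subsystem L => X.Cubelet → ZMod X.modulus) X _
    · intro Y hY
      exact Pi.single_eq_of_ne (M := fun X : Subsystem L => X.Cubelet → ZMod X.modulus) hY _
  cases X with
  | corner => exact twist (.inl rfl) hc.sum_corner
  | edge => exact twist (.inr rfl) hc.sum_edge
  | wing k =>
    have : c.ori (.wing k) = 0 := funext (hc.ori_wing k)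
    rw [this]; exact zero_mem _
  | plus k =>
    have : c.ori (.plus k) = 0 := funext fun p => Subsingleton.elim (α := ZMod 1) _ _
    rw [this]; exact zero_mem _
  | center i j =>
    have : c.ori (.center i j) = 0 := funext fun p => Subsingleton.elim (α := ZMod 1) _ _
    rw [this]; exact zero_mem _

/-- The permutations enter the First Law only through their signs, and zero orientations satisfy the
rest of it. -/
theorem FirstLaw.of_sgn {c d : Config L} (hc : c.FirstLaw) (hs : ∀ X, d.sgn X = c.sgn X)
    (hd : d.ori = 0) : d.FirstLaw := by
  constructor
  · simp only [hs, hc.sgn_edge]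
  · intro i; simp only [hs, hc.sgn_xCenter i]
  · intro k; simp only [hs, hc.sgn_plus k]
  · intro i j hij; simp only [hs, hc.sgn_oblique i j hij]
  · simp [hd]
  · simp [hd]
  · simp [hd]

/-- Every configuration that satisfies the First Law is a coupled 2-cycle, followed by 3-cycles,
followed by opposite twists. -/
theorem FirstLaw.three_steps {c : Config L} (hc : c.FirstLaw) :
    ∃ c₁ c₂ : Config L, (c₁ = 1 ∨ c₁.IsCoupledTwoCycle) ∧ (∀ X, c₁.sgn X = c.sgn X) ∧
      c₂.perm = c.perm ∧
      -- Quantifying over `W` lets one factorization serve both the configurations reached by slices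
      -- and the preimages of the groups that the move classes generate.
      (∀ W : Subgroup (Config L), (∀ d : Config L, d.IsThreeCycle → d ∈ W) → c₂ * c₁⁻¹ ∈ W) ∧
      (∀ W : Subgroup (Config L), (∀ d : Config L, d.IsOppositeTwist → d ∈ W) →
        c * c₂⁻¹ ∈ W) := by
  classical
  have key : ∀ X : Subsystem L, ∃ π : Perm X.Cubelet, Perm.sign π = c.sgn X ∧
      (c.sgn X = 1 → π = 1) ∧ (c.sgn X ≠ 1 → π.IsSwap) := by
    intro X
    by_cases h : c.sgn X = 1
    · exact ⟨1, by simp [h], fun _ => rfl, fun h' => absurd h h'⟩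
    · have h1 : c.perm X ≠ 1 := by
        intro h2; apply h; simp [sgn, h2]
      obtain ⟨p, hp⟩ : ∃ p, c.perm X p ≠ p := by
        by_contra! h2; exact h1 (Equiv.ext h2)
      -- Any transposition would do; the moved cubelet `p` provides two distinct cubelets.
      refine ⟨Equiv.swap (c.perm X p) p, ?_, fun h' => absurd h' h, fun _ => ⟨_, _, hp, rfl⟩⟩
      rw [Perm.sign_swap hp]
      exact ((Int.units_eq_one_or _).resolve_left h).symm
  choose π h1 h2 h3 using key
  have hs : ∀ X, (ofPerm L π).sgn X = c.sgn X := h1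
  refine ⟨ofPerm L π, ofPerm L c.perm, ?_, hs, rfl, ?_, ?_⟩
  · by_cases h : ∀ X, c.sgn X = 1
    · left
      have : π = 1 := funext fun X => h2 X (h X)
      rw [this, map_one]
    · right
      push Not at h
      -- The family consists of the subsystems in which `c` is odd.
      refine ⟨rfl, hc.of_sgn hs rfl, {X | c.sgn X ≠ 1}, h, fun X hX => h3 X hX, fun X hX => ?_⟩
      exact h2 X (by simpa using hX)
  · intro W hW
    rw [← map_inv, ← map_mul]
    refine ofPerm_mem_of_threeCycles hW _ fun X => ?_
    rw [Pi.mul_apply, Pi.inv_apply, map_mul, map_inv, h1 X]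
    exact mul_inv_cancel _
  · intro W hW
    refine mem_of_oppositeTwists hW ?_ ?_
    · exact (firstLaw L).mul_mem hc ((firstLaw L).inv_mem (hc.of_sgn (fun _ => rfl) rfl))
    · funext X
      rw [mul_perm, inv_perm, ofPerm_perm, mul_inv_cancel, Pi.one_apply]

/-! ### Swap-moves respect the First Law -/

theorem IsThreeCycle.firstLaw {c : Config L} (hc : c.IsThreeCycle) : c.FirstLaw := by
  obtain ⟨h0, X, h1, h2⟩ := hc
  refine (Config.firstLaw L).one_mem.of_sgn (fun Y => ?_) h0
  rw [sgn_one]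
  by_cases h : Y = X
  · subst h; exact h1.sign
  · rw [sgn, h2 Y h, map_one]

theorem IsOppositeTwist.firstLaw {c : Config L} (hc : c.IsOppositeTwist) : c.FirstLaw := by
  obtain ⟨h0, X, hX, ⟨p, q, hpq, h1⟩, h2⟩ := hc
  have hs : ∀ Y, c.sgn Y = 1 := fun Y => by simp [sgn, h0]
  have hsum : ∀ Y, ∑ p, c.ori Y p = 0 := by
    intro Y
    by_cases h : Y = X
    · subst h; simp [h1]
    · simp [h2 Y h]
  constructor
  · simp [hs]
  · simp [hs]
  · simp [hs]
  · simp [hs]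
  · exact hsum _
  · exact hsum _
  · intro k p
    have : Subsystem.wing k ≠ X := by rcases hX with rfl | rfl <;> simp
    rw [h2 _ this]; rfl

/-- Each class of moves is closed under inversion, so that sequences of moves, without inverses,
already produce whole group orbits. -/
theorem IsThreeCycle.inv {c : Config L} (hc : c.IsThreeCycle) : c⁻¹.IsThreeCycle := by
  obtain ⟨h0, X, h1, h2⟩ := hc
  refine ⟨?_, X, h1.inv, fun Y hY => by rw [inv_perm, h2 Y hY, inv_one]⟩
  funext X p
  simp [inv_ori, h0]

theorem IsOppositeTwist.inv {c : Config L} (hc : c.IsOppositeTwist) : c⁻¹.IsOppositeTwist := by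
  obtain ⟨h0, X, hX, ⟨p, q, hpq, h1⟩, h2⟩ := hc
  refine ⟨funext fun Y => by simp [inv_perm, h0], X, hX, ⟨q, p, hpq.symm, ?_⟩, fun Y hY => ?_⟩
  · funext r
    simp [inv_ori, h0, h1]
  · funext r
    simp [inv_ori, h0, h2 Y hY]

theorem IsCoupledTwoCycle.inv {c : Config L} (hc : c.IsCoupledTwoCycle) :
    c⁻¹.IsCoupledTwoCycle := by
  obtain ⟨h0, h1, S, hS, h2, h3⟩ := hc
  refine ⟨?_, (Config.firstLaw L).inv_mem h1, S, hS, fun X hX => ?_, fun X hX => ?_⟩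
  · funext X p
    simp [inv_ori, h0]
  · obtain ⟨p, q, hpq, h⟩ := h2 X hX
    exact ⟨p, q, hpq, by rw [inv_perm, h, Equiv.swap_inv]⟩
  · rw [inv_perm, h3 X hX, inv_one]

end Config

/-! ### Inverses of moves, and reachable colourings as orbits -/

/-- Configurations of the classes 1-3. -/
theorem mem_swapMoves {L : ℕ} {μ : Marking} {g : Perm (Facelet L)} :
    g ∈ swapMoves L μ ↔ ∃ c : Config L,
      (c.IsThreeCycle ∨ c.IsOppositeTwist ∨ c.IsCoupledTwoCycle) ∧ c.realize μ = g := by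
  constructor
  · rintro ((⟨c, hc, rfl⟩ | ⟨c, hc, rfl⟩) | ⟨c, hc, rfl⟩)
    · exact ⟨c, .inl hc, rfl⟩
    · exact ⟨c, .inr (.inl hc), rfl⟩
    · exact ⟨c, .inr (.inr hc), rfl⟩
  · rintro ⟨c, hc | hc | hc, rfl⟩
    · exact .inl (.inl ⟨c, hc, rfl⟩)
    · exact .inl (.inr ⟨c, hc, rfl⟩)
    · exact .inr ⟨c, hc, rfl⟩

theorem inv_mem_swapMoves {L : ℕ} {μ : Marking} {g : Perm (Facelet L)} (hg : g ∈ swapMoves L μ) :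
    g⁻¹ ∈ swapMoves L μ := by
  rw [mem_swapMoves] at hg ⊢
  obtain ⟨c, hc, rfl⟩ := hg
  refine ⟨c⁻¹, ?_, map_inv (Config.realizeHom μ) c⟩
  exact hc.imp (·.inv) (.imp (·.inv) (·.inv))

theorem inv_mem_sliceRotations {L : ℕ} {g : Perm (Facelet L)} (hg : g ∈ sliceRotations L) :
    g⁻¹ ∈ sliceRotations L := by
  obtain ⟨b, c, h0, h1, rfl | rfl⟩ := hg
  · exact ⟨b, c, h0, h1, .inr rfl⟩
  · exact ⟨b, c, h0, h1, .inl (inv_inv _)⟩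

/-- Finite sequences of moves reach the orbit under the generated group. -/
theorem reachable_eq {L : ℕ} {M : Set (Perm (Facelet L))} (hM : ∀ g ∈ M, g⁻¹ ∈ M)
    (s : Colouring L) :
    reachable M s = {s' | ∃ g ∈ Subgroup.closure M, s' = s ∘ ⇑g⁻¹} := by
  ext s'
  constructor
  · intro h
    change Relation.ReflTransGen _ s s' at h
    induction h with
    | refl => exact ⟨1, one_mem _, by simp⟩
    | tail _ h ih =>
      obtain ⟨g, hg, rfl⟩ := ih
      obtain ⟨k, hk, rfl⟩ := h
      refine ⟨k * g, mul_mem (Subgroup.subset_closure hk) hg, ?_⟩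
      simp [Function.comp_assoc, Perm.coe_mul]
  · rintro ⟨g, hg, rfl⟩
    have step : ∀ k ∈ M, ∀ y : Perm (Facelet L), s ∘ ⇑y⁻¹ ∈ reachable M s →
        s ∘ ⇑(k * y)⁻¹ ∈ reachable M s := by
      intro k hk y hy
      refine Relation.ReflTransGen.tail hy ⟨k, hk, ?_⟩
      simp [Function.comp_assoc, Perm.coe_mul]
    induction hg using Subgroup.closure_induction_left with
    | one => exact Relation.ReflTransGen.refl
    | mul_left k hk y _ ih => exact step k hk y ih
    | inv_mul_cancel k hk y _ ih => exact step k⁻¹ (hM k hk) y ih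

/-! ### Coordinates adapted to an axis -/

theorem turn_add_one (b : Fin 3) (p : Vec) : turn b p (b + 1) = -p (b + 2) := by
  fin_cases b <;> simp [turn]

theorem turn_add_two (b : Fin 3) (p : Vec) : turn b p (b + 2) = p (b + 1) := by
  fin_cases b <;> simp [turn]

theorem turnInv_add_one (b : Fin 3) (p : Vec) : turnInv b p (b + 1) = p (b + 2) := by
  fin_cases b <;> simp [turnInv]

theorem turnInv_add_two (b : Fin 3) (p : Vec) : turnInv b p (b + 2) = -p (b + 1) := by
  fin_cases b <;> simp [turnInv]

theorem axis_cases (b a : Fin 3) : a = b ∨ a = b + 1 ∨ a = b + 2 := by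
  decide +revert

theorem exists_axis (b : Fin 3) (P : Fin 3 → Prop) :
    (∃ a, P a) ↔ P b ∨ P (b + 1) ∨ P (b + 2) := by
  constructor
  · rintro ⟨a, ha⟩
    rcases axis_cases b a with rfl | rfl | rfl <;> simp [ha]
  · rintro (h | h | h) <;> exact ⟨_, h⟩

theorem forall_axis (b : Fin 3) (P : Fin 3 → Prop) :
    (∀ a, P a) ↔ P b ∧ P (b + 1) ∧ P (b + 2) := by
  constructor
  · intro h; exact ⟨h _, h _, h _⟩
  · rintro ⟨h1, h2, h3⟩ a
    rcases axis_cases b a with rfl | rfl | rfl <;> assumption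

theorem vec_ext (b : Fin 3) {p q : Vec} (h0 : p b = q b) (h1 : p (b + 1) = q (b + 1))
    (h2 : p (b + 2) = q (b + 2)) : p = q :=
  funext ((forall_axis b fun a => p a = q a).2 ⟨h0, h1, h2⟩)

theorem axis_add (b : Fin 3) :
    b + 1 + 1 = b + 2 ∧ b + 1 + 2 = b ∧ b + 2 + 1 = b ∧ b + 2 + 2 = b + 1 := by
  decide +revert

theorem chir_eq (b : Fin 3) (p : Vec) : chir p = p b * p (b + 1) * p (b + 2) := by
  fin_cases b <;> simp [chir] <;> ring

/-- A quarter turn exchanges two coordinates and negates one of them. Conventions that depend on the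
sign of `chir` therefore switch at every turn. -/
theorem chir_turn (b : Fin 3) (p : Vec) : chir (turn b p) = -chir p := by
  rw [chir_eq b, chir_eq b, turn_at, turn_add_one, turn_add_two]; ring

theorem turnAxis_add_one (b a : Fin 3) : turnAxis b (a + 1) = turnAxis b a + 2 := by
  decide +revert

theorem turnAxis_add_two (b a : Fin 3) : turnAxis b (a + 2) = turnAxis b a + 1 := by
  decide +revert

/-- Membership of subsystems, in coordinates adapted to the axis `b`. -/
theorem Subsystem.mem_iff (b : Fin 3) {L : ℕ} (X : Subsystem L) (p : Vec) : X.Mem p ↔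
    match X with
    | .corner => |p b| = rad L ∧ |p (b + 1)| = rad L ∧ |p (b + 2)| = rad L
    | .edge => 0 < rad L ∧ ((p b = 0 ∧ |p (b + 1)| = rad L ∧ |p (b + 2)| = rad L) ∨
        (p (b + 1) = 0 ∧ |p (b + 2)| = rad L ∧ |p b| = rad L) ∨
        (p (b + 2) = 0 ∧ |p b| = rad L ∧ |p (b + 1)| = rad L))
    | .wing k => (|p b| = (k : ℕ) + 1 ∧ |p (b + 1)| = rad L ∧ |p (b + 2)| = rad L) ∨
        (|p (b + 1)| = (k : ℕ) + 1 ∧ |p (b + 2)| = rad L ∧ |p b| = rad L) ∨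
        (|p (b + 2)| = (k : ℕ) + 1 ∧ |p b| = rad L ∧ |p (b + 1)| = rad L)
    | .plus k =>
      (|p b| = rad L ∧ ((|p (b + 1)| = (k : ℕ) + 1 ∧ p (b + 2) = 0) ∨
        (p (b + 1) = 0 ∧ |p (b + 2)| = (k : ℕ) + 1))) ∨
      (|p (b + 1)| = rad L ∧ ((|p (b + 2)| = (k : ℕ) + 1 ∧ p b = 0) ∨
        (p (b + 2) = 0 ∧ |p b| = (k : ℕ) + 1))) ∨
      (|p (b + 2)| = rad L ∧ ((|p b| = (k : ℕ) + 1 ∧ p (b + 1) = 0) ∨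
        (p b = 0 ∧ |p (b + 1)| = (k : ℕ) + 1)))
    | .center i j =>
      (|p b| = rad L ∧ ((0 < chir p ∧ |p (b + 1)| = (i : ℕ) + 1 ∧ |p (b + 2)| = (j : ℕ) + 1) ∨
        (chir p < 0 ∧ |p (b + 1)| = (j : ℕ) + 1 ∧ |p (b + 2)| = (i : ℕ) + 1))) ∨
      (|p (b + 1)| = rad L ∧ ((0 < chir p ∧ |p (b + 2)| = (i : ℕ) + 1 ∧ |p b| = (j : ℕ) + 1) ∨
        (chir p < 0 ∧ |p (b + 2)| = (j : ℕ) + 1 ∧ |p b| = (i : ℕ) + 1))) ∨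
      (|p (b + 2)| = rad L ∧ ((0 < chir p ∧ |p b| = (i : ℕ) + 1 ∧ |p (b + 1)| = (j : ℕ) + 1) ∨
        (chir p < 0 ∧ |p b| = (j : ℕ) + 1 ∧ |p (b + 1)| = (i : ℕ) + 1))) := by
  obtain ⟨e1, e2, e3, e4⟩ := axis_add b
  cases X with
  | corner => exact forall_axis b _
  | edge => simp only [Subsystem.Mem, exists_axis b, e1, e2, e3, e4]; tauto
  | wing k => simp only [Subsystem.Mem, exists_axis b, e1, e2, e3, e4]
  | plus k => simp only [Subsystem.Mem, exists_axis b, e1, e2, e3, e4]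
  | center i j => simp only [Subsystem.Mem, exists_axis b, e1, e2, e3, e4]

/-- For centre pieces, a turn reverses the cyclic order of the two inner axes and the sign of `chir`
at once; the two effects cancel, which keeps `center i j` apart from its mirror image. -/
theorem Subsystem.Mem.turn {L : ℕ} {X : Subsystem L} {p : Vec} (h : X.Mem p) (b : Fin 3) :
    X.Mem (turn b p) := by
  rw [Subsystem.mem_iff b] at h ⊢
  simp only [turn_at, turn_add_one, turn_add_two, chir_turn, abs_neg, neg_eq_zero,
    Left.neg_neg_iff, Left.neg_pos_iff] at h ⊢
  cases X with
  | corner => tauto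
  | edge => tauto
  | wing k => tauto
  | plus k => tauto
  | center i j =>
    rcases h with ⟨h0, ⟨h1, h2, h3⟩ | ⟨h1, h2, h3⟩⟩ | ⟨h0, ⟨h1, h2, h3⟩ | ⟨h1, h2, h3⟩⟩ |
      ⟨h0, ⟨h1, h2, h3⟩ | ⟨h1, h2, h3⟩⟩ <;> simp [h0, h1, h2, h3]

theorem Subsystem.Mem.turnInv {L : ℕ} {X : Subsystem L} {p : Vec} (h : X.Mem p) (b : Fin 3) :
    X.Mem (turnInv b p) := by
  have : RubikCube.turnInv b p = RubikCube.turn b (RubikCube.turn b (RubikCube.turn b p)) := by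
    refine vec_ext b ?_ ?_ ?_ <;>
      simp [turn_at, turn_add_one, turn_add_two, turnInv_at, turnInv_add_one, turnInv_add_two]
  rw [this]
  exact ((h.turn b).turn b).turn b

/-! ### Slices acting on positions -/

/-- The quarter turn of the layer `{p | p b = c}`, as a permutation of positions. -/
def slicePos (b : Fin 3) (c : ℤ) : Perm Vec where
  toFun p := if p b = c then turn b p else p
  invFun p := if p b = c then turnInv b p else p
  left_inv p := by
    by_cases h : p b = c
    · simp [h, turn_at, turnInv_turn]
    · simp [h]
  right_inv p := by
    by_cases h : p b = c
    · simp [h, turnInv_at, turn_turnInv]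
    · simp [h]

theorem slicePos_apply (b : Fin 3) (c : ℤ) (p : Vec) :
    slicePos b c p = if p b = c then turn b p else p := rfl

theorem slicePos_inv_apply (b : Fin 3) (c : ℤ) (p : Vec) :
    (slicePos b c)⁻¹ p = if p b = c then turnInv b p else p := rfl

theorem slice_pos {L : ℕ} (b : Fin 3) (c : ℤ) (f : Facelet L) :
    (slice L b c f).pos = slicePos b c f.pos := by
  simp only [slice, slicePos, coe_fn_mk]
  split_ifs <;> rfl

theorem slice_inv_pos {L : ℕ} (b : Fin 3) (c : ℤ) (f : Facelet L) :
    ((slice L b c)⁻¹ f).pos = (slicePos b c)⁻¹ f.pos := by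
  rw [Perm.eq_inv_iff_eq, ← slice_pos]
  exact congrArg _ (apply_symm_apply (slice L b c) f)

theorem Subsystem.mem_slicePos {L : ℕ} (X : Subsystem L) (b : Fin 3) (c : ℤ) (p : Vec) :
    X.Mem (slicePos b c p) ↔ X.Mem p := by
  rw [slicePos_apply]
  split_ifs
  · exact ⟨fun h => by simpa [turnInv_turn] using h.turnInv b, fun h => h.turn b⟩
  · rfl

/-- The quarter turn of a layer, acting on the cubelets of a subsystem. -/
def cubeletSlice {L : ℕ} (b : Fin 3) (c : ℤ) (X : Subsystem L) : Perm X.Cubelet :=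
  (slicePos b c).subtypePerm fun p => X.mem_slicePos b c p

theorem cubeletSlice_val {L : ℕ} (b : Fin 3) (c : ℤ) (X : Subsystem L) (p : X.Cubelet) :
    (cubeletSlice b c X p).1 = slicePos b c p.1 := rfl

/-! ### Signs of slices -/

/-- The permutation is a disjoint union of 4-cycles, one for each element of `ι`, and a 4-cycle is
odd. -/
theorem sign_of_quarter_turns {α ι : Type*} [Fintype α] [DecidableEq α] [Fintype ι]
    (π : Perm α) (e : ι × Fin 4 ↪ α) (h : ∀ i t, π (e (i, t)) = e (i, t + 1))
    (h' : ∀ x ∉ Set.range e, π x = x) : Perm.sign π = (-1) ^ Fintype.card ι := by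
  classical
  have : π = Perm.viaFintypeEmbedding (prodCongrRight fun _ : ι => finRotate 4) e := by
    ext1 x
    by_cases hx : x ∈ Set.range e
    · obtain ⟨⟨i, t⟩, rfl⟩ := hx
      rw [h, Perm.viaFintypeEmbedding_apply_image, prodCongrRight_apply, finRotate_apply]
    · rw [h' x hx, Perm.viaFintypeEmbedding_apply_notMem_range _ _ hx]
  rw [this, Perm.viaFintypeEmbedding_sign, Perm.sign_prodCongrRight, Finset.prod_const, sign_finRotate]
  rfl

/-- The positions of a subsystem in a given layer and a quarter of that layer. -/
def quarter {L : ℕ} (X : Subsystem L) (b : Fin 3) (c : ℤ) : Set X.Cubelet :=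
  {q | q.1 b = c ∧ 0 < q.1 (b + 1) ∧ 0 ≤ q.1 (b + 2)}

/-- The half-open quarter is a fundamental domain for the quarter turn on a layer without its axis;
`hc` excludes positions on the axis. -/
theorem sign_cubeletSlice {L : ℕ} (X : Subsystem L) (b : Fin 3) (c : ℤ)
    (hc : ∀ p, X.Mem p → p b = c → ¬(p (b + 1) = 0 ∧ p (b + 2) = 0)) :
    Perm.sign (cubeletSlice b c X) = (-1) ^ (quarter X b c).ncard := by
  classical
  let T : X.Cubelet → X.Cubelet := fun p => ⟨turn b p.1, p.2.turn b⟩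
  have T0 : ∀ p, (T p).1 b = p.1 b := fun p => turn_at b p.1
  have T1 : ∀ p, (T p).1 (b + 1) = -p.1 (b + 2) := fun p => turn_add_one b p.1
  have T2 : ∀ p, (T p).1 (b + 2) = p.1 (b + 1) := fun p => turn_add_two b p.1
  have hT : ∀ p, p.1 b = c → cubeletSlice b c X p = T p := by
    intro p hp
    ext1
    rw [cubeletSlice_val, slicePos_apply, if_pos hp]
  have ext' : ∀ p q : X.Cubelet, p.1 b = q.1 b → p.1 (b + 1) = q.1 (b + 1) →
      p.1 (b + 2) = q.1 (b + 2) → p = q := fun p q h0 h1 h2 => Subtype.ext (vec_ext b h0 h1 h2)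
  let E : quarter X b c × Fin 4 → X.Cubelet := fun x =>
    match x.2 with
    | 0 => x.1
    | 1 => T x.1
    | 2 => T (T x.1)
    | 3 => T (T (T x.1))
  have hE : Function.Injective E := by
    rintro ⟨⟨p, hp⟩, s⟩ ⟨⟨q, hq⟩, t⟩ h
    have hp' := hp
    have hq' := hq
    obtain ⟨p0, p1, p2⟩ := hp
    obtain ⟨q0, q1, q2⟩ := hq
    have h1 := congrArg (fun x : X.Cubelet => x.1 (b + 1)) h
    have h2 := congrArg (fun x : X.Cubelet => x.1 (b + 2)) h
    have hpq : (p.1 (b + 1) = q.1 (b + 1) ∧ p.1 (b + 2) = q.1 (b + 2)) → p = q :=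
      fun hh => ext' p q (p0.trans q0.symm) hh.1 hh.2
    -- The signs of the two coordinates across the axis tell the four images of the quarter apart.
    fin_cases s <;> fin_cases t <;> simp [E, T1, T2] at h1 h2 <;>
      first
        | (exfalso; omega)
        | (obtain rfl := hpq (by omega); rfl)
  have key := sign_of_quarter_turns (cubeletSlice b c X) ⟨E, hE⟩ ?_ ?_
  · rw [key, ← Nat.card_eq_fintype_card]; rfl
  · rintro ⟨q, q0, q1, q2⟩ t
    change cubeletSlice b c X (E _) = E _
    fin_cases t
    · exact hT _ q0
    · exact hT _ ((T0 q).trans q0)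
    · exact hT _ (by simp [E, T0, q0])
    · refine (hT _ (by simp [E, T0, q0])).trans ?_
      refine ext' _ _ ?_ ?_ ?_ <;> simp [E, T0, T1, T2]
  · intro p hp
    by_contra hne
    apply hp
    have p0 : p.1 b = c := by
      by_contra h
      apply hne
      ext1
      rw [cubeletSlice_val, slicePos_apply, if_neg h]
    have h0 := hc p.1 p.2 p0
    have inv : ∀ q : X.Cubelet, T (T (T (T q))) = q := by
      intro q
      refine ext' _ _ ?_ ?_ ?_ <;> simp [T0, T1, T2]
    -- The sign pattern shows how many turns bring `p` into the quarter; the index in `Fin 4` counts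
    -- the turns that lead back.
    rcases lt_trichotomy (p.1 (b + 1)) 0 with h1 | h1 | h1 <;>
      rcases lt_trichotomy (p.1 (b + 2)) 0 with h2 | h2 | h2
    · exact ⟨(⟨T (T p), by simp only [quarter, Set.mem_ofPred_eq, T0, T1, T2]; omega⟩, 2), inv p⟩
    · exact ⟨(⟨T (T p), by simp only [quarter, Set.mem_ofPred_eq, T0, T1, T2]; omega⟩, 2), inv p⟩
    · exact ⟨(⟨T (T (T p)), by simp only [quarter, Set.mem_ofPred_eq, T0, T1, T2]; omega⟩, 1), inv p⟩
    · exact ⟨(⟨T p, by simp only [quarter, Set.mem_ofPred_eq, T0, T1, T2]; omega⟩, 3), inv p⟩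
    · exact absurd ⟨h1, h2⟩ h0
    · exact ⟨(⟨T (T (T p)), by simp only [quarter, Set.mem_ofPred_eq, T0, T1, T2]; omega⟩, 1), inv p⟩
    · exact ⟨(⟨T p, by simp only [quarter, Set.mem_ofPred_eq, T0, T1, T2]; omega⟩, 3), inv p⟩
    · exact ⟨(⟨p, by simp only [quarter, Set.mem_ofPred_eq]; omega⟩, 0), rfl⟩
    · exact ⟨(⟨p, by simp only [quarter, Set.mem_ofPred_eq]; omega⟩, 0), rfl⟩

/-- The vector with given coordinates along `b`, `b + 1` and `b + 2`. -/
def vecOf (b : Fin 3) (x y z : ℤ) : Vec := fun a => if a = b then x else if a = b + 1 then y else z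

theorem vecOf_at (b : Fin 3) (x y z : ℤ) : vecOf b x y z b = x := by simp [vecOf]

theorem vecOf_add_one (b : Fin 3) (x y z : ℤ) : vecOf b x y z (b + 1) = y := by
  fin_cases b <;> simp [vecOf]

theorem vecOf_add_two (b : Fin 3) (x y z : ℤ) : vecOf b x y z (b + 2) = z := by
  fin_cases b <;> simp [vecOf]

theorem vecOf_eta (b : Fin 3) (p : Vec) : vecOf b (p b) (p (b + 1)) (p (b + 2)) = p :=
  vec_ext b (vecOf_at ..) (vecOf_add_one ..) (vecOf_add_two ..)

theorem ncard_quarter_eq {L : ℕ} (X : Subsystem L) (b : Fin 3) (c : ℤ) :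
    (quarter X b c).ncard =
      {u : ℤ × ℤ | X.Mem (vecOf b c u.1 u.2) ∧ 0 < u.1 ∧ 0 ≤ u.2}.ncard := by
  refine Set.ncard_congr (fun q _ => (q.1 (b + 1), q.1 (b + 2))) ?_ ?_ ?_
  · rintro ⟨q, hX⟩ ⟨rfl, q1, q2⟩
    refine ⟨?_, q1, q2⟩
    rwa [vecOf_eta]
  · rintro ⟨p, hp⟩ ⟨q, hq⟩ ⟨p0, p1, p2⟩ ⟨q0, q1, q2⟩ h
    simp only [Prod.mk.injEq] at h
    exact Subtype.ext (vec_ext b (p0.trans q0.symm) h.1 h.2)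
  · rintro ⟨y, z⟩ ⟨hX, h1, h2⟩
    refine ⟨⟨vecOf b c y z, hX⟩, ⟨vecOf_at .., ?_, ?_⟩, ?_⟩
    · simpa only [vecOf_add_one] using h1
    · simpa only [vecOf_add_two] using h2
    · simp only [vecOf_add_one, vecOf_add_two]

/-- The number of positions of a subsystem in a quarter of a layer. -/
def quarterCount {L : ℕ} (c : ℤ) : Subsystem L → ℕ
  | .corner => if |c| = rad L then 1 else 0
  | .edge => if |c| = rad L then 1 else 0
  | .wing k => 2 * (if |c| = rad L then 1 else 0) + if |c| = (k : ℕ) + 1 then 1 else 0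
  | .plus k => (if |c| = rad L then 1 else 0) + if |c| = (k : ℕ) + 1 then 1 else 0
  | .center i j => (if |c| = rad L then 1 else 0) + ((if |c| = (i : ℕ) + 1 then 1 else 0) +
      if |c| = (j : ℕ) + 1 then 1 else 0)

/-- In each subsystem at most three points can lie in a quarter of a layer, each subject to a
condition on `|c|`. Unneeded points are placeholders with the condition `False`. -/
theorem ncard_three {α : Type*} {x y z : α} (hxy : x ≠ y) (hxz : x ≠ z) (hyz : y ≠ z)
    (P Q R : Prop) [Decidable P] [Decidable Q] [Decidable R] :
    {u | (P ∧ u = x) ∨ (Q ∧ u = y) ∨ (R ∧ u = z)}.ncard =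
      (if P then 1 else 0) + ((if Q then 1 else 0) + if R then 1 else 0) := by
  by_cases hP : P <;> by_cases hQ : Q <;> by_cases hR : R <;>
    simp only [hP, hQ, hR, true_and, false_and, or_false, false_or, if_true, if_false]
  · exact Set.ncard_eq_three.2 ⟨x, y, z, hxy, hxz, hyz, rfl⟩
  · exact Set.ncard_eq_two.2 ⟨x, y, hxy, rfl⟩
  · exact Set.ncard_eq_two.2 ⟨x, z, hxz, rfl⟩
  · exact Set.ncard_singleton x
  · exact Set.ncard_eq_two.2 ⟨y, z, hyz, rfl⟩
  · exact Set.ncard_singleton y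
  · exact Set.ncard_singleton z
  · exact Set.ncard_empty α

/-- With the coordinate `c` along `b` given, membership is solved for the other two coordinates `y >
0` and `z ≥ 0`. Since `c ≠ 0`, positions of the middle layer do not occur. -/
theorem ncard_quarter {L : ℕ} (X : Subsystem L) (b : Fin 3) {c : ℤ} (hc : c ≠ 0)
    (hr : 0 < rad L) : (quarter X b c).ncard = quarterCount c X := by
  rw [ncard_quarter_eq]
  simp only [Subsystem.mem_iff b, vecOf_at, vecOf_add_one, vecOf_add_two]
  have hc' := abs_pos.2 hc
  cases X with
  | corner =>
    have key := ncard_three (x := (rad L, rad L)) (y := (rad L, 0)) (z := (0, 0))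
      (by simp [hr.ne']) (by simp [hr.ne']) (by simp [hr.ne']) (|c| = rad L) False False
    simp only [if_false, add_zero, false_and, or_false] at key
    rw [quarterCount, ← key]
    congr 1
    ext ⟨y, z⟩
    have := abs_cases y; have := abs_cases z
    simp only [Set.mem_ofPred_eq, Prod.mk.injEq]
    omega
  | edge =>
    have key := ncard_three (x := (rad L, 0)) (y := (rad L, rad L)) (z := (0, 0))
      (by simp [hr.ne]) (by simp [hr.ne']) (by simp [hr.ne']) (|c| = rad L) False False
    simp only [if_false, add_zero, false_and, or_false] at key
    rw [quarterCount, ← key]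
    congr 1
    ext ⟨y, z⟩
    have := abs_cases y; have := abs_cases z
    simp only [Set.mem_ofPred_eq, Prod.mk.injEq]
    omega
  | wing k =>
    rw [quarterCount]
    simp only
    obtain ⟨k', hk⟩ : ∃ k' : ℤ, k' = (k : ℕ) + 1 := ⟨_, rfl⟩
    have hk0 := index_lt k
    rw [← hk] at hk0 ⊢
    have key := ncard_three (x := (k', rad L)) (y := (rad L, k')) (z := (rad L, rad L))
      (by rw [ne_eq, Prod.mk.injEq]; omega) (by rw [ne_eq, Prod.mk.injEq]; omega)
      (by rw [ne_eq, Prod.mk.injEq]; omega) (|c| = rad L) (|c| = rad L) (|c| = k')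
    rw [two_mul, add_assoc, ← key]
    congr 1
    ext ⟨y, z⟩
    have := abs_cases y; have := abs_cases z
    simp only [Set.mem_ofPred_eq, Prod.mk.injEq]
    omega
  | plus k =>
    rw [quarterCount]
    simp only
    obtain ⟨k', hk⟩ : ∃ k' : ℤ, k' = (k : ℕ) + 1 := ⟨_, rfl⟩
    have hk0 := index_lt k
    rw [← hk] at hk0 ⊢
    have key := ncard_three (α := ℤ × ℤ) (x := (k', 0)) (y := (rad L, 0)) (z := (0, 0))
      (by rw [ne_eq, Prod.mk.injEq]; omega) (by rw [ne_eq, Prod.mk.injEq]; omega)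
      (by rw [ne_eq, Prod.mk.injEq]; omega) (|c| = rad L) (|c| = k') False
    simp only [if_false, add_zero, false_and, or_false] at key
    rw [← key]
    congr 1
    ext ⟨y, z⟩
    have := abs_cases y; have := abs_cases z
    simp only [Set.mem_ofPred_eq, Prod.mk.injEq]
    omega
  | center i j =>
    rw [quarterCount]
    simp only
    obtain ⟨i', hi⟩ : ∃ i' : ℤ, i' = (i : ℕ) + 1 := ⟨_, rfl⟩
    obtain ⟨j', hj⟩ : ∃ j' : ℤ, j' = (j : ℕ) + 1 := ⟨_, rfl⟩
    have hi0 := index_lt i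
    have hj0 := index_lt j
    rw [← hi] at hi0 ⊢
    rw [← hj] at hj0 ⊢
    have hchir : ∀ y z : ℤ, 0 < y → 0 < z → ((0 < chir (vecOf b c y z) ↔ 0 < c) ∧
        (chir (vecOf b c y z) < 0 ↔ c < 0)) := by
      intro y z hy hz
      rw [chir_eq b, vecOf_at, vecOf_add_one, vecOf_add_two]
      exact ⟨by rw [mul_pos_iff_of_pos_right hz, mul_pos_iff_of_pos_right hy],
        by rw [← not_le, mul_nonneg_iff_of_pos_right hz, mul_nonneg_iff_of_pos_right hy, not_le]⟩
    have hchir0 : ∀ y : ℤ, chir (vecOf b c y 0) = 0 := by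
      intro y
      rw [chir_eq b, vecOf_add_two, mul_zero]
    -- Inside the quarter, `chir` has the sign of `c`, so this sign decides the order in which `i`
    -- and `j` occur.
    rcases lt_or_gt_of_ne hc with h | h
    · rw [← ncard_three (x := (j', i')) (y := (rad L, j')) (z := (i', rad L))
        (by rw [ne_eq, Prod.mk.injEq]; omega) (by rw [ne_eq, Prod.mk.injEq]; omega)
        (by rw [ne_eq, Prod.mk.injEq]; omega) (|c| = rad L) (|c| = i') (|c| = j')]
      congr 1
      ext ⟨y, z⟩
      simp only [Set.mem_ofPred_eq, Prod.mk.injEq]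
      by_cases hyz : 0 < y ∧ 0 < z
      · obtain ⟨hy, hz⟩ := hyz
        simp only [hchir y z hy hz, h, h.not_gt, hy, hz.le, abs_of_pos hy, abs_of_pos hz, true_and,
          false_and, false_or, and_true]
        tauto
      -- In the quarter only `z = 0` remains; there `chir` vanishes, so no centre piece lies there,
      -- and the listed points have positive coordinates.
      · have := abs_cases z
        constructor
        · rintro ⟨h1, h2, h3⟩
          have h4 : z = 0 := by clear h1; omega
          subst h4
          simp [hchir0] at h1
        · intro h5
          exfalso
          omega
    · rw [← ncard_three (x := (i', j')) (y := (j', rad L)) (z := (rad L, i'))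
        (by rw [ne_eq, Prod.mk.injEq]; omega) (by rw [ne_eq, Prod.mk.injEq]; omega)
        (by rw [ne_eq, Prod.mk.injEq]; omega) (|c| = rad L) (|c| = i') (|c| = j')]
      congr 1
      ext ⟨y, z⟩
      simp only [Set.mem_ofPred_eq, Prod.mk.injEq]
      by_cases hyz : 0 < y ∧ 0 < z
      · obtain ⟨hy, hz⟩ := hyz
        simp only [hchir y z hy hz, h, h.not_gt, hy, hz.le, abs_of_pos hy, abs_of_pos hz, true_and,
          false_and, or_false, and_true]
        tauto
      · have := abs_cases z
        constructor
        · rintro ⟨h1, h2, h3⟩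
          have h4 : z = 0 := by clear h1; omega
          subst h4
          simp [hchir0] at h1
        · intro h5
          exfalso
          omega

/-! ### Slices as configurations -/

theorem innerAxis_eq {L : ℕ} {p : Vec} {a : Fin 3} (h0 : |p a| ≠ rad L)
    (h1 : |p (a + 1)| = rad L) (h2 : |p (a + 2)| = rad L) : innerAxis L p = a := by
  unfold innerAxis
  fin_cases a <;> simp_all

theorem outerAxis_eq {L : ℕ} {p : Vec} {a : Fin 3} (h0 : |p a| = rad L)
    (h1 : |p (a + 1)| ≠ rad L) (h2 : |p (a + 2)| ≠ rad L) : outerAxis L p = a := by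
  unfold outerAxis
  fin_cases a <;> simp_all

theorem innerAxis_turn {L : ℕ} {p : Vec} {a : Fin 3} (b : Fin 3) (h0 : |p a| ≠ rad L)
    (h1 : |p (a + 1)| = rad L) (h2 : |p (a + 2)| = rad L) :
    innerAxis L (turn b p) = turnAxis b a := by
  refine innerAxis_eq ?_ ?_ ?_
  · rwa [abs_turn]
  · rwa [← abs_turn b, turnAxis_add_two] at h2
  · rwa [← abs_turn b, turnAxis_add_one] at h1

theorem outerAxis_turn {L : ℕ} {p : Vec} {a : Fin 3} (b : Fin 3) (h0 : |p a| = rad L)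
    (h1 : |p (a + 1)| ≠ rad L) (h2 : |p (a + 2)| ≠ rad L) :
    outerAxis L (turn b p) = turnAxis b a := by
  refine outerAxis_eq ?_ ?_ ?_
  · rwa [abs_turn]
  · rwa [← abs_turn b, turnAxis_add_two] at h2
  · rwa [← abs_turn b, turnAxis_add_one] at h1

/-- A function on positions whose differences are the orientations that a turn about `b`
produces. -/
def potential {L : ℕ} (μ : Marking) (b : Fin 3) : (X : Subsystem L) → Vec → ZMod X.modulus
  | .corner, p => show Fin 3 from if 0 < chir p then μ.corner p - b else b - μ.corner p
  | .edge, p => show ZMod 2 from μ.edge p + if innerAxis L p = b + 1 then 1 else 0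
  | .wing _, _ => 0
  | .plus _, _ => 0
  | .center _ _, _ => 0

theorem Subsystem.Mem.chir_ne_zero_of_corner {L : ℕ} {p : Vec}
    (h : (Subsystem.corner : Subsystem L).Mem p) (hr : 0 < rad L) : chir p ≠ 0 := by
  have key : ∀ a, p a ≠ 0 := fun a h0 => by
    have := h a
    rw [h0, abs_zero] at this
    omega
  simp [chir, key]

theorem Subsystem.Mem.chir_ne_zero_of_wing {L : ℕ} {k : Fin ((L - 3) / 2)} {p : Vec}
    (h : (Subsystem.wing k : Subsystem L).Mem p) : chir p ≠ 0 := by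
  obtain ⟨a, h0, h1, h2⟩ := h
  have hk := index_lt k
  rw [chir_eq a]
  have h0' : p a ≠ 0 := abs_pos.1 (by omega)
  have h1' : p (a + 1) ≠ 0 := abs_pos.1 (by omega)
  have h2' : p (a + 2) ≠ 0 := abs_pos.1 (by omega)
  exact mul_ne_zero (mul_ne_zero h0' h1') h2'

/-- On axes, a turn about `b` is the reflection `a ↦ 2b - a` modulo 3, and it flips `chir`. Opposite
counting directions on the two sides make the resulting shift of facelet numbers independent of `t`.
For wings the reversed order and the flipped `chir` cancel. -/
theorem turnAxis_axis {L : ℕ} (μ : Marking) (X : Subsystem L) (b : Fin 3) {p : Vec}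
    (hp : X.Mem p) (hb : p b ≠ 0) (t : ZMod X.modulus) :
    turnAxis b (X.axis μ p t) =
      X.axis μ (turn b p) (t + (potential μ b X p - potential μ b X (turn b p))) := by
  have hch := chir_turn b p
  cases X with
  | corner =>
    have hr : 0 < rad L := by rw [← hp b]; exact abs_pos.2 hb
    have h0 := hp.chir_ne_zero_of_corner hr
    have key1 : ∀ b m m' t : Fin 3, turnAxis b (m + t) = m' - (t + ((m - b) - (b - m'))) := by
      decide
    have key2 : ∀ b m m' t : Fin 3, turnAxis b (m - t) = m' + (t + ((b - m) - (m' - b))) := by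
      decide
    simp only [Subsystem.axis, potential]
    rcases lt_or_gt_of_ne h0 with h | h
    · rw [if_neg h.not_gt, if_pos (by omega), if_neg h.not_gt, if_pos (by omega)]
      exact key2 b _ _ t
    · rw [if_pos h, if_neg (by omega), if_pos h, if_neg (by omega)]
      exact key1 b _ _ t
  | edge =>
    obtain ⟨a, h0, h1, h2, h3⟩ := hp
    have hi := innerAxis_eq (L := L) (p := p) (a := a) (by rw [h0, abs_zero]; exact h3.ne) h1 h2
    have hi' := innerAxis_turn (L := L) (p := p) (a := a) b
      (by rw [h0, abs_zero]; exact h3.ne) h1 h2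
    -- Only edges outside the middle layer occur. Their inner axis alternates between `b + 1` and `b
    -- + 2`, which is what the indicator in the potential records.
    have hab : a ≠ b := by rintro rfl; exact hb h0
    simp only [Subsystem.axis, potential, hi, hi']
    have key : ∀ (a b : Fin 3) (m m' t : ZMod 2), a ≠ b →
        turnAxis b (if m + t = 0 then a + 1 else a + 2) =
          if m' + (t + ((m + if a = b + 1 then 1 else 0) -
            (m' + if turnAxis b a = b + 1 then 1 else 0))) = 0
          then turnAxis b a + 1 else turnAxis b a + 2 := by decide
    exact key a b _ _ t hab
  | wing k =>
    have h0 := hp.chir_ne_zero_of_wing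
    obtain ⟨a, ha, h1, h2⟩ := hp
    have hk := index_lt k
    have hi := innerAxis_eq (L := L) (p := p) (a := a) (by omega) h1 h2
    have hi' := innerAxis_turn (L := L) (p := p) (a := a) b (by omega) h1 h2
    have key : ∀ (a b : Fin 3) (t : ZMod 2) (P Q : Prop) [Decidable P] [Decidable Q], (P ↔ ¬Q) →
        turnAxis b (if t = 0 ↔ P then a + 1 else a + 2) =
          if t + (0 - 0) = 0 ↔ Q then turnAxis b a + 1 else turnAxis b a + 2 := by
      intro a b t P Q _ _ hPQ
      rw [sub_zero, add_zero]
      by_cases ht : t = 0 <;> by_cases hQ : Q <;>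
        simp [ht, hQ, hPQ, turnAxis_add_one, turnAxis_add_two]
    simp only [Subsystem.axis, potential, hi, hi']
    exact key a b t _ _ (by omega)
  | plus k =>
    obtain ⟨a, h0, h1⟩ := hp
    have hk := index_lt k
    have h2 : |p (a + 1)| ≠ rad L ∧ |p (a + 2)| ≠ rad L := by
      rcases h1 with ⟨h1, h2⟩ | ⟨h1, h2⟩
      · rw [h1, h2, abs_zero]; omega
      · rw [h1, h2, abs_zero]; omega
    simp only [Subsystem.axis, outerAxis_eq h0 h2.1 h2.2, outerAxis_turn b h0 h2.1 h2.2]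
  | center i j =>
    obtain ⟨a, h0, h1⟩ := hp
    have hi := index_lt i
    have hj := index_lt j
    have h2 : |p (a + 1)| ≠ rad L ∧ |p (a + 2)| ≠ rad L := by
      rcases h1 with ⟨-, h1, h2⟩ | ⟨-, h1, h2⟩ <;> rw [h1, h2] <;> omega
    simp only [Subsystem.axis, outerAxis_eq h0 h2.1 h2.2, outerAxis_turn b h0 h2.1 h2.2]

/-- The configuration of a slice-rotation. -/
def sliceConfig {L : ℕ} (μ : Marking) (b : Fin 3) (c : ℤ) : Config L where
  perm X := cubeletSlice b c X
  ori X p := potential μ b X p.1 - potential μ b X (cubeletSlice b c X p).1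

/-- For odd `L` the indices in `Fin ((L - 3) / 2)` thus reach every layer strictly between a middle
and an outer one. -/
theorem rad_eq {L : ℕ} (hodd : Odd L) (hL : 3 ≤ L) : rad L = ((L - 3) / 2 : ℕ) + 1 := by
  obtain ⟨m, rfl⟩ := hodd
  unfold rad
  omega

theorem axis_add_ne (a : Fin 3) : a + 1 ≠ a ∧ a + 2 ≠ a := by
  decide +revert

/-- Only the face centres have no number. -/
theorem mem_range_faceletAt {L : ℕ} (hodd : Odd L) (hL : 3 ≤ L) (μ : Marking) (f : Facelet L)
    (hf : ¬(f.pos (f.axis + 1) = 0 ∧ f.pos (f.axis + 2) = 0)) : f ∈ Set.range (faceletAt (L := L) μ) := by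
  have hrad := rad_eq hodd hL
  obtain ⟨p, a, hb, ho⟩ := f
  simp only at hf
  have make : ∀ (X : Subsystem L) (h : X.Mem p) (t : ZMod X.modulus), X.axis μ p t = a →
      (⟨p, a, hb, ho⟩ : Facelet L) ∈ Set.range (faceletAt (L := L) μ) := by
    intro X h t hX
    refine ⟨⟨X, ⟨p, h⟩, t⟩, ?_⟩
    ext1
    · rfl
    · exact hX
  have index : ∀ x : ℤ, 0 < x → x < rad L → ∃ k : Fin ((L - 3) / 2), x = (k : ℕ) + 1 := by
    intro x h0 h1
    exact ⟨⟨(x - 1).toNat, by omega⟩, by simp; omega⟩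
  -- Central edges and wings together: once the inner axis `e` is excluded, two axes remain, and the
  -- two facelet numbers hit both.
  have two : ∀ (X : Subsystem L) (h : X.Mem p) (e : Fin 3), innerAxis L p = e → e ≠ a →
      (X = .edge ∨ ∃ k, X = .wing k) →
      (⟨p, a, hb, ho⟩ : Facelet L) ∈ Set.range (faceletAt (L := L) μ) := by
    rintro X h e he hea (rfl | ⟨k, rfl⟩)
    · have key : ∀ (m : ZMod 2) (e a : Fin 3), e ≠ a →
          ∃ t : ZMod 2, (if m + t = 0 then e + 1 else e + 2) = a := by decide
      obtain ⟨t, ht⟩ := key (μ.edge p) e a hea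
      refine make _ h t ?_
      simp only [Subsystem.axis, he]
      exact ht
    · have key : ∀ (P : Prop) [Decidable P] (e a : Fin 3), e ≠ a →
          ∃ t : ZMod 2, (if t = 0 ↔ P then e + 1 else e + 2) = a := by
        intro P _ e a hea
        rcases axis_cases e a with h | rfl | rfl
        · exact absurd h.symm hea
        · by_cases hP : P
          · exact ⟨0, by simp [hP]⟩
          · exact ⟨1, by simp [hP]⟩
        · by_cases hP : P
          · exact ⟨1, by simp [hP]⟩
          · exact ⟨0, by simp [hP]⟩
      obtain ⟨t, ht⟩ := key (0 < chir p) e a hea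
      refine make _ h t ?_
      simp only [Subsystem.axis, he]
      exact ht
  obtain ⟨e1, e2, e3, e4⟩ := axis_add a
  have ne1 : a + 1 ≠ a ∧ a + 2 ≠ a := axis_add_ne a
  have b1 := hb (a + 1)
  have b2 := hb (a + 2)
  by_cases h1 : |p (a + 1)| = rad L
  · by_cases h2 : |p (a + 2)| = rad L
    · have hX : (Subsystem.corner : Subsystem L).Mem p :=
        (forall_axis a fun a => |p a| = rad L).2 ⟨ho, h1, h2⟩
      have key : ∀ m a : Fin 3, ∃ t : Fin 3, m + t = a := by decide
      have key' : ∀ m a : Fin 3, ∃ t : Fin 3, m - t = a := by decide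
      by_cases hc : 0 < chir p
      · obtain ⟨t, ht⟩ := key (μ.corner p) a
        exact make _ hX t (by simp only [Subsystem.axis, if_pos hc]; exact ht)
      · obtain ⟨t, ht⟩ := key' (μ.corner p) a
        exact make _ hX t (by simp only [Subsystem.axis, if_neg hc]; exact ht)
    · have hi : innerAxis L p = a + 2 := innerAxis_eq h2 (by rwa [e3]) (by rwa [e4])
      by_cases h0 : p (a + 2) = 0
      · exact two .edge ⟨a + 2, h0, by rwa [e3], by rwa [e4], by omega⟩ _ hi ne1.2 (.inl rfl)
      · obtain ⟨k, hk⟩ := index _ (abs_pos.2 h0) (lt_of_le_of_ne b2 h2)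
        exact two (.wing k) ⟨a + 2, hk, by rwa [e3], by rwa [e4]⟩ _ hi ne1.2 (.inr ⟨k, rfl⟩)
  · by_cases h2 : |p (a + 2)| = rad L
    · have hi : innerAxis L p = a + 1 := innerAxis_eq h1 (by rwa [e1]) (by rwa [e2])
      by_cases h0 : p (a + 1) = 0
      · exact two .edge ⟨a + 1, h0, by rwa [e1], by rwa [e2], by omega⟩ _ hi ne1.1 (.inl rfl)
      · obtain ⟨k, hk⟩ := index _ (abs_pos.2 h0) (lt_of_le_of_ne b1 h1)
        exact two (.wing k) ⟨a + 1, hk, by rwa [e1], by rwa [e2]⟩ _ hi ne1.1 (.inr ⟨k, rfl⟩)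
    · have hi : outerAxis L p = a := outerAxis_eq ho h1 h2
      by_cases h3 : p (a + 1) = 0
      · have h4 : p (a + 2) ≠ 0 := fun h4 => hf ⟨h3, h4⟩
        obtain ⟨k, hk⟩ := index _ (abs_pos.2 h4) (lt_of_le_of_ne b2 h2)
        exact make (.plus k) ⟨a, ho, .inr ⟨h3, hk⟩⟩ 0 hi
      · obtain ⟨k, hk⟩ := index _ (abs_pos.2 h3) (lt_of_le_of_ne b1 h1)
        by_cases h4 : p (a + 2) = 0
        · exact make (.plus k) ⟨a, ho, .inl ⟨hk, h4⟩⟩ 0 hi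
        · obtain ⟨l, hl⟩ := index _ (abs_pos.2 h4) (lt_of_le_of_ne b2 h2)
          have h5 : p a ≠ 0 := abs_pos.1 (by omega)
          have h6 : chir p ≠ 0 := by
            rw [chir_eq a]
            exact mul_ne_zero (mul_ne_zero h5 h3) h4
          rcases lt_or_gt_of_ne h6 with h | h
          -- On the negative side of the mirror the two distances are read in the opposite order.
          · exact make (.center l k) ⟨a, ho, .inr ⟨h, hk, hl⟩⟩ 0 hi
          · exact make (.center k l) ⟨a, ho, .inl ⟨h, hk, hl⟩⟩ 0 hi

theorem slice_apply_of_eq {L : ℕ} {b : Fin 3} {c : ℤ} {f : Facelet L} (h : f.pos b = c) :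
    slice L b c f = f.turn b := by
  simp [slice, h]

theorem slice_apply_of_ne {L : ℕ} {b : Fin 3} {c : ℤ} {f : Facelet L} (h : f.pos b ≠ c) :
    slice L b c f = f := by
  simp [slice, h]

theorem realize_sliceConfig {L : ℕ} (hodd : Odd L) (hL : 3 ≤ L) (μ : Marking) (b : Fin 3) {c : ℤ}
    (hc : c ≠ 0) : (sliceConfig μ b c : Config L).realize μ = slice L b c := by
  rw [Config.realize_eq_iff]
  constructor
  · rintro X ⟨p, hp⟩ t
    by_cases h : p b = c
    · rw [slice_apply_of_eq (by exact h)]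
      have hpos : ((cubeletSlice b c X) ⟨p, hp⟩).1 = turn b p := by
        rw [cubeletSlice_val, slicePos_apply, if_pos h]
      ext1
      · exact hpos.symm
      · change turnAxis b (X.axis μ p t) = X.axis μ ((cubeletSlice b c X) ⟨p, hp⟩).1
          (t + (potential μ b X p - potential μ b X ((cubeletSlice b c X) ⟨p, hp⟩).1))
        rw [hpos]
        exact turnAxis_axis μ X b hp (by rwa [h]) t
    · rw [slice_apply_of_ne (by exact h)]
      have hpos : (cubeletSlice b c X) ⟨p, hp⟩ = ⟨p, hp⟩ := by
        ext1
        rw [cubeletSlice_val, slicePos_apply, if_neg h]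
      congr 1
      simp [sliceConfig, hpos]
  · intro f hf
    by_cases h : f.pos b = c
    · by_contra hne
      apply hf
      refine mem_range_faceletAt hodd hL μ f ?_
      rintro ⟨h1, h2⟩
      apply hne
      -- The other two coordinates of a face centre vanish and `c ≠ 0`, so this centre lies on the
      -- axis of the turn and is carried to itself.
      have hb : f.axis = b := by
        rcases axis_cases f.axis b with rfl | rfl | rfl
        · rfl
        · exact absurd (h.symm.trans h1) hc
        · exact absurd (h.symm.trans h2) hc
      subst hb
      rw [slice_apply_of_eq h]
      ext1
      · exact vec_ext f.axis (turn_at _ _) ((turn_add_one _ _).trans (by rw [h1, h2, neg_zero]))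
          ((turn_add_two _ _).trans (by rw [h1, h2]))
      · simp only [Facelet.turn, turnAxis]
        refine swap_apply_of_ne_of_ne ?_ ?_ <;> generalize f.axis = a <;> decide +revert
    · exact slice_apply_of_ne h

theorem sgn_sliceConfig {L : ℕ} (hr : 0 < rad L) (μ : Marking) (b : Fin 3) {c : ℤ} (hc : c ≠ 0)
    (X : Subsystem L) : (sliceConfig μ b c : Config L).sgn X = (-1) ^ quarterCount c X := by
  rw [← ncard_quarter X b hc hr]
  refine sign_cubeletSlice X b c ?_
  -- Positions with two zero coordinates belong to no subsystem.
  rintro p hp - ⟨h1, h2⟩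
  rw [Subsystem.mem_iff b] at hp
  simp only [h1, h2, abs_zero] at hp
  cases X <;> simp at hp <;> omega

/-- An outer turn is odd on every subsystem except the wings. A turn of the layer with index `k` is
odd exactly on `wing k`, `plus k` and the `center i j` with exactly one index equal to `k`. -/
theorem sliceConfig_firstLaw {L : ℕ} (hr : 0 < rad L) (μ : Marking) (b : Fin 3) {c : ℤ}
    (hc : c ≠ 0) : (sliceConfig μ b c : Config L).FirstLaw := by
  have hsum : ∀ X : Subsystem L, ∑ p, (sliceConfig μ b c : Config L).ori X p = 0 := by
    intro X
    simp only [sliceConfig, Finset.sum_sub_distrib]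
    -- The differences of the potential cancel, since the slice permutes the cubelets.
    rw [Equiv.sum_comp (cubeletSlice b c X) (fun p => potential μ b X p.1), sub_self]
  constructor
  · simp only [sgn_sliceConfig hr μ b hc, quarterCount]
  · intro i
    simp only [sgn_sliceConfig hr μ b hc, quarterCount, ← two_mul, pow_add, pow_mul]
    simp
  · intro k
    simp only [sgn_sliceConfig hr μ b hc, quarterCount, pow_add, pow_mul]
    simp
  · intro i j _
    simp only [sgn_sliceConfig hr μ b hc, quarterCount, pow_add, pow_mul]
    simp
  · exact hsum _
  · exact hsum _
  · intro k p
    simp [sliceConfig, potential]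

/-! ### Groups generated by 3-cycles -/

/-- A permutation group contains the alternating group if its 3-cycles connect all points. -/
theorem alternatingGroup_le_of_connected {α : Type*} [Fintype α] [DecidableEq α] [Nontrivial α]
    (K : Subgroup (Perm α))
    (h : ∀ a b, Relation.EqvGen (fun a b => ∃ π ∈ K, π.IsThreeCycle ∧ π a = b) a b) :
    alternatingGroup α ≤ K := by
  have htrans : MulAction.IsPretransitive K α := by
    refine ⟨fun a b => ?_⟩
    induction h a b with
    | rel a b hab => obtain ⟨π, hπ, -, rfl⟩ := hab; exact ⟨⟨π, hπ⟩, rfl⟩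
    | refl a => exact ⟨1, one_smul _ a⟩
    | symm a b _ ih => obtain ⟨g, rfl⟩ := ih; exact ⟨g⁻¹, inv_smul_smul g a⟩
    | trans a b c _ _ ih1 ih2 =>
      obtain ⟨g, rfl⟩ := ih1
      obtain ⟨k, rfl⟩ := ih2
      exact ⟨k * g, mul_smul k g a⟩
  have hprim : MulAction.IsPreprimitive K α := by
    refine { htrans with isTrivialBlock_of_isBlock := ?_ }
    intro B hB
    by_cases hs : B.Subsingleton
    · exact .inl hs
    right
    rw [Set.not_subsingleton_iff] at hs
    obtain ⟨x, hx, y, hy, hxy⟩ := hs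
    have step : ∀ π ∈ K, π.IsThreeCycle → ∀ a ∈ B, π a ∈ B := by
      intro π hπ h3 a ha
      rcases hB.smul_eq_or_disjoint (⟨π, hπ⟩ : K) with h1 | h1
      · rw [← h1]
        exact ⟨a, ha, rfl⟩
      · exfalso
        have out : ∀ z ∈ B, π z ∉ B := fun z hz hz' =>
          Set.disjoint_left.1 h1 ⟨z, hz, rfl⟩ hz'
        -- A 3-cycle that carries the block off itself would move two of its points and their two
        -- images: four points, one too many.
        have hsub : ({x, y, π x, π y} : Finset α) ⊆ π.support := by
          have mx : π x ≠ x := fun e => out x hx (e.symm ▸ hx)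
          have my : π y ≠ y := fun e => out y hy (e.symm ▸ hy)
          intro z hz
          simp only [Finset.mem_insert, Finset.mem_singleton] at hz
          rcases hz with rfl | rfl | rfl | rfl <;> simpa [Perm.mem_support]
        have hcard := Finset.card_le_card hsub
        rw [h3.card_support, Finset.card_insert_of_notMem, Finset.card_insert_of_notMem,
          Finset.card_insert_of_notMem, Finset.card_singleton] at hcard
        · omega
        · simpa using hxy
        · have e1 : y ≠ π x := fun e => out x hx (e ▸ hy)
          have e2 : y ≠ π y := fun e => out y hy (e ▸ hy)
          simp [e1, e2]
        · have e1 : x ≠ π x := fun e => out x hx (e ▸ hx)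
          have e2 : x ≠ π y := fun e => out y hy (e ▸ hx)
          simp [hxy, e1, e2]
    have all : ∀ a b, a ∈ B ↔ b ∈ B := by
      intro a b
      induction h a b with
      | rel a b hab =>
        obtain ⟨π, hπ, h3, rfl⟩ := hab
        refine ⟨step π hπ h3 a, fun hb => ?_⟩
        simpa using step π⁻¹ (inv_mem hπ) h3.inv _ hb
      | refl a => rfl
      | symm a b _ ih => exact ih.symm
      | trans a b c _ _ ih1 ih2 => exact ih1.trans ih2
    exact Set.eq_univ_of_forall fun a => (all x a).1 hx
  -- Without a 3-cycle the generated equivalence relation would be equality.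
  obtain ⟨π, hπ, h3⟩ : ∃ π ∈ K, π.IsThreeCycle := by
    by_contra! hno
    obtain ⟨a, b, hab⟩ := exists_pair_ne α
    refine hab ?_
    clear hab
    induction h a b with
    | rel a b hab => obtain ⟨π, hπ, h3, -⟩ := hab; exact absurd h3 (hno π hπ)
    | refl a => rfl
    | symm a b _ ih => exact ih.symm
    | trans a b c _ _ ih1 ih2 => exact ih1.trans ih2
  exact Perm.alternatingGroup_le_of_isPreprimitive_of_isThreeCycle_mem hprim h3 hπ

/-! ### Commutators of permutations whose supports meet in one point -/

section Commutator

variable {α : Type*} {s u : Perm α}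

theorem commutator_apply {x y w z : α} (h1 : u y = x) (h2 : s w = y) (h3 : s (u w) = z) :
    (s * u * s⁻¹ * u⁻¹) x = z := by
  subst h1 h2 h3
  simp

/-- A point outside `D`, `s D` and `u D` is affected by at most one of the two permutations, whose
action the commutator undoes. A set `D` is needed because, for facelets, the common support consists
of several facelets of one cubelet. -/
theorem commutator_apply_of_not_moved {D : Set α} (hD : ∀ x, s x ≠ x → u x ≠ x → x ∈ D) {x : α}
    (h0 : x ∉ D) (h1 : ∀ y ∈ D, s y ≠ x) (h2 : ∀ y ∈ D, u y ≠ x) :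
    (s * u * s⁻¹ * u⁻¹) x = x := by
  by_cases hu : u x = x
  · obtain ⟨w, hw⟩ := s.surjective x
    by_cases hw' : u w = w
    · exact commutator_apply hu hw (by rw [hw', hw])
    · have hsw : s w = w := by
        by_contra h
        exact h1 w (hD w h hw') hw
      exact absurd (by rw [← hsw, hw, hu]) hw'
  · have hs : s x = x := by
      by_contra h
      exact h0 (hD x h hu)
    obtain ⟨y, hy⟩ := u.surjective x
    have hyx : u y ≠ y := by
      intro h
      rw [← hy] at hu
      exact hu (by rw [h, h])
    have hsy : s y = y := by
      by_contra h
      exact h2 y (hD y h hyx) hy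
    exact commutator_apply hy hsy (by rw [hy, hs])

/-- Apart from `P`, each permutation fixes what the other moves. The commutator then runs through
the cycle `P ↦ s P ↦ u P ↦ P`. -/
theorem commutator_apply_of_moved {P : α} (hD : ∀ x, s x ≠ x → u x ≠ x → x = P)
    (hs : s P ≠ P) (hu : u P ≠ P) :
    (s * u * s⁻¹ * u⁻¹) P = s P ∧ (s * u * s⁻¹ * u⁻¹) (s P) = u P ∧
      (s * u * s⁻¹ * u⁻¹) (u P) = P := by
  have fs : ∀ x, x ≠ P → u x ≠ x → s x = x := fun x h h' => by
    by_contra h2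
    exact h (hD x h2 h')
  have fu : ∀ x, x ≠ P → s x ≠ x → u x = x := fun x h h' => by
    by_contra h2
    exact h (hD x h' h2)
  refine ⟨?_, ?_, ?_⟩
  · obtain ⟨y, hy⟩ := u.surjective P
    have h1 : y ≠ P := fun h => hu (by rw [h] at hy; exact hy)
    have h2 : s y = y := fs y h1 (by rw [hy]; exact h1.symm)
    exact commutator_apply hy h2 (by rw [hy])
  · have h1 : u (s P) = s P := fu _ hs (fun h => hs (s.injective h))
    have h2 : s (u P) = u P := fs _ hu (fun h => hu (u.injective h))
    exact commutator_apply h1 rfl h2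
  · obtain ⟨w, hw⟩ := s.surjective P
    have h1 : w ≠ P := fun h => hs (by rw [h] at hw; exact hw)
    have h2 : u w = w := fu w h1 (by rw [hw]; exact h1.symm)
    exact commutator_apply rfl hw (by rw [h2, hw])

theorem isThreeCycle_of_apply [Fintype α] [DecidableEq α] {π : Perm α} {a b c : α}
    (hab : a ≠ b) (hac : a ≠ c) (hbc : b ≠ c) (h1 : π a = b) (h2 : π b = c) (h3 : π c = a)
    (h : ∀ x, x ≠ a → x ≠ b → x ≠ c → π x = x) : π.IsThreeCycle := by
  have : π = swap a c * swap a b := by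
    ext1 x
    rw [Perm.mul_apply]
    by_cases ha : x = a
    · subst ha; rw [h1, swap_apply_left, swap_apply_of_ne_of_ne hab.symm hbc]
    by_cases hb : x = b
    · subst hb; rw [h2, swap_apply_right, swap_apply_left]
    by_cases hc : x = c
    · subst hc; rw [h3, swap_apply_of_ne_of_ne hac.symm hbc.symm, swap_apply_right]
    · rw [h x ha hb hc, swap_apply_of_ne_of_ne ha hb, swap_apply_of_ne_of_ne ha hc]
  rw [this]
  exact Perm.isThreeCycle_swap_mul_swap_same hac hab hbc.symm

end Commutator

/-! ### Middle slices normalize the slice-rotation group -/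

/-- A layer outside the cube contains no facelets, so no bound on `c` is needed. -/
theorem slice_mem_sliceGroup {L : ℕ} (b : Fin 3) {c : ℤ} (hc : c ≠ 0) :
    slice L b c ∈ sliceGroup L := by
  by_cases h : |c| ≤ rad L
  · exact Subgroup.subset_closure ⟨b, c, hc, h, .inl rfl⟩
  · have : slice L b c = 1 := by
      ext1 f
      refine slice_apply_of_ne ?_
      rintro rfl
      exact h (f.bound b)
    rw [this]
    exact one_mem _

/-- The rotation of the whole cube. -/
def rotation (L : ℕ) (b : Fin 3) : Perm (Facelet L) where
  toFun f := f.turn b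
  invFun f := f.turnInv b
  left_inv f := Facelet.ext (turnInv_turn b f.pos) (turnAxis_turnAxis b f.axis)
  right_inv f := Facelet.ext (turn_turnInv b f.pos) (turnAxis_turnAxis b f.axis)

theorem prod_slice_apply {L : ℕ} (b : Fin 3) (l : List ℤ) (hl : l.Nodup) (f : Facelet L) :
    (l.map (slice L b)).prod f = if f.pos b ∈ l then f.turn b else f := by
  induction l with
  | nil => simp
  | cons c l ih =>
    rw [List.nodup_cons] at hl
    rw [List.map_cons, List.prod_cons, Perm.mul_apply, ih hl.2]
    by_cases h : f.pos b ∈ l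
    · have h' : f.pos b ≠ c := fun e => hl.1 (e ▸ h)
      rw [if_pos h, if_pos (List.mem_cons_of_mem _ h), slice_apply_of_ne]
      exact (turn_at b f.pos).trans_ne h'
    · rw [if_neg h]
      by_cases h' : f.pos b = c
      · rw [slice_apply_of_eq h', if_pos (by simp [h'])]
      · rw [slice_apply_of_ne h', if_neg (by simp [h, h'])]

/-- All parallel slices together rotate the whole cube, so the middle slice is this rotation with
the other slices undone. -/
theorem exists_middle_slice_eq (L : ℕ) (b : Fin 3) :
    ∃ g ∈ sliceGroup L, slice L b 0 = rotation L b * g := by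
  let l := ((Finset.Icc (-rad L) (rad L)).erase 0).toList
  refine ⟨((l.map (slice L b)).prod)⁻¹, inv_mem (list_prod_mem ?_), ?_⟩
  · intro g hg
    rw [List.mem_map] at hg
    obtain ⟨c, hc, rfl⟩ := hg
    rw [Finset.mem_toList, Finset.mem_erase] at hc
    exact slice_mem_sliceGroup b hc.1
  · rw [eq_mul_inv_iff_mul_eq, ← List.prod_cons, ← List.map_cons (f := slice L b)]
    ext1 f
    rw [prod_slice_apply b (0 :: l) (by simp [l, Finset.nodup_toList])]
    refine if_pos ?_
    have := abs_le.1 (f.bound b)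
    simp only [List.mem_cons, l, Finset.mem_toList, Finset.mem_erase, Finset.mem_Icc]
    tauto

/-- A rotation carries layers to layers. The direction along axis `b + 2` goes to the negative
direction along axis `b + 1`, which negates the coordinate of the layer and inverts the turn. -/
theorem rotation_conj_slice (L : ℕ) (b a : Fin 3) (c : ℤ) :
    rotation L b * slice L a c = slice L b c * rotation L b ∨
    rotation L b * slice L a c = slice L (b + 2) c * rotation L b ∨
    rotation L b * slice L a c = (slice L (b + 1) (-c))⁻¹ * rotation L b := by
  have comm : ∀ b a : Fin 3, turnAxis b (turnAxis (b + 1) a) = turnAxis (b + 2) (turnAxis b a) ∧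
      turnAxis (b + 1) (turnAxis b (turnAxis (b + 2) a)) = turnAxis b a := by decide
  obtain ⟨e1, e2, e3, e4⟩ := axis_add b
  rcases axis_cases b a with rfl | rfl | rfl
  · left
    ext1 f
    by_cases h : f.pos a = c
    · have h' : (f.turn a).pos a = c := (turn_at a f.pos).trans h
      simp only [Perm.mul_apply, slice_apply_of_eq h, rotation, coe_fn_mk, slice_apply_of_eq h']
    · have h' : (f.turn a).pos a ≠ c := (turn_at a f.pos).trans_ne h
      simp only [Perm.mul_apply, slice_apply_of_ne h, rotation, coe_fn_mk, slice_apply_of_ne h']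
  · right; left
    ext1 f
    by_cases h : f.pos (b + 1) = c
    · have h' : (f.turn b).pos (b + 2) = c := (turn_add_two b f.pos).trans h
      simp only [Perm.mul_apply, slice_apply_of_eq h, rotation, coe_fn_mk, slice_apply_of_eq h']
      ext1
      · have t1 := turn_add_one (b + 1)
        have t2 := turn_add_two (b + 1)
        have t3 := turn_add_one (b + 2)
        have t4 := turn_add_two (b + 2)
        simp only [e1, e2, e3, e4] at t1 t2 t3 t4
        refine vec_ext b ?_ ?_ ?_ <;>
          simp only [Facelet.turn, turn_at, turn_add_one, turn_add_two, t1, t2, t3, t4, neg_neg]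
      · exact (comm b _).1
    · have h' : (f.turn b).pos (b + 2) ≠ c := (turn_add_two b f.pos).trans_ne h
      simp only [Perm.mul_apply, slice_apply_of_ne h, rotation, coe_fn_mk, slice_apply_of_ne h']
  · right; right
    rw [eq_inv_mul_iff_mul_eq]
    ext1 f
    by_cases h : f.pos (b + 2) = c
    · have h1 : (slice L (b + 2) c f) = f.turn (b + 2) := slice_apply_of_eq h
      have h' : ((f.turn (b + 2)).turn b).pos (b + 1) = -c := by
        refine (turn_add_one b _).trans ?_
        rw [← h]
        exact congrArg _ (turn_at _ _)
      simp only [Perm.mul_apply, h1, rotation, coe_fn_mk, slice_apply_of_eq h']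
      ext1
      · have t1 := turn_add_one (b + 1)
        have t2 := turn_add_two (b + 1)
        have t3 := turn_add_one (b + 2)
        have t4 := turn_add_two (b + 2)
        simp only [e1, e2, e3, e4] at t1 t2 t3 t4
        refine vec_ext b ?_ ?_ ?_ <;>
          simp only [Facelet.turn, turn_at, turn_add_one, turn_add_two, t1, t2, t3, t4, neg_neg]
      · exact (comm b _).2
    · have h' : (f.turn b).pos (b + 1) ≠ -c := by
        refine (turn_add_one b f.pos).trans_ne ?_
        simpa using h
      simp only [Perm.mul_apply, slice_apply_of_ne h, rotation, coe_fn_mk, slice_apply_of_ne h']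

theorem rotation_conj_mem {L : ℕ} (b : Fin 3) {g : Perm (Facelet L)} (hg : g ∈ sliceGroup L) :
    rotation L b * g * (rotation L b)⁻¹ ∈ sliceGroup L := by
  have key : sliceGroup L ≤ (sliceGroup L).comap (MulAut.conj (rotation L b)).toMonoidHom := by
    refine (Subgroup.closure_le _).2 ?_
    have single : ∀ (a : Fin 3) (c : ℤ), c ≠ 0 →
        rotation L b * slice L a c * (rotation L b)⁻¹ ∈ sliceGroup L := by
      intro a c hc
      rcases rotation_conj_slice L b a c with h | h | h
      · rw [h, mul_inv_cancel_right]; exact slice_mem_sliceGroup _ hc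
      · rw [h, mul_inv_cancel_right]; exact slice_mem_sliceGroup _ hc
      · rw [h, mul_inv_cancel_right]; exact inv_mem (slice_mem_sliceGroup _ (neg_ne_zero.2 hc))
    rintro g ⟨a, c, hc, -, rfl | rfl⟩
    · exact single a c hc
    · rw [SetLike.mem_coe, inv_mem_iff]; exact single a c hc
  exact key hg

/-- Commutators with arbitrary slices, including the middle ones. -/
theorem slice_commutator_mem {L : ℕ} (b : Fin 3) (c : ℤ) {g : Perm (Facelet L)}
    (hg : g ∈ sliceGroup L) : slice L b c * g * (slice L b c)⁻¹ * g⁻¹ ∈ sliceGroup L := by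
  refine mul_mem ?_ (inv_mem hg)
  by_cases hc : c = 0
  · subst hc
    obtain ⟨k, hk, h⟩ := exists_middle_slice_eq L b
    -- The middle slice is a rotation times an element of the group, and both factors normalize the
    -- group.
    have : slice L b 0 * g * (slice L b 0)⁻¹ =
        rotation L b * (k * g * k⁻¹) * (rotation L b)⁻¹ := by
      rw [h]; group
    rw [this]
    exact rotation_conj_mem b (mul_mem (mul_mem hk hg) (inv_mem hk))
  · have hs := slice_mem_sliceGroup (L := L) b hc
    exact mul_mem (mul_mem hs hg) (inv_mem hs)

/-! ### Local 3-cycles -/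

/-- The lawful configurations form a subgroup, so it suffices to look at the generators. -/
theorem exists_config_of_mem_sliceGroup {L : ℕ} (hodd : Odd L) (hL : 3 ≤ L) (μ : Marking)
    {g : Perm (Facelet L)} (hg : g ∈ sliceGroup L) :
    ∃ c : Config L, c.FirstLaw ∧ c.realize μ = g := by
  have hr : 0 < rad L := by rw [rad_eq hodd hL]; omega
  have key : sliceGroup L ≤ (Config.firstLaw L).map (Config.realizeHom μ) := by
    refine (Subgroup.closure_le _).2 ?_
    have single : ∀ (b : Fin 3) (c : ℤ), c ≠ 0 →
        slice L b c ∈ (Config.firstLaw L).map (Config.realizeHom μ) := fun b c hc =>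
      ⟨sliceConfig μ b c, sliceConfig_firstLaw hr μ b hc, realize_sliceConfig hodd hL μ b hc⟩
    rintro g ⟨b, c, hc, -, rfl | rfl⟩
    · exact single b c hc
    · exact inv_mem (single b c hc)
  obtain ⟨c, hc, h⟩ := key hg
  exact ⟨c, hc, h⟩

/-- The configurations that slice-rotations reach. -/
noncomputable def sliceConfigs (L : ℕ) (μ : Marking) : Subgroup (Config L) :=
  (sliceGroup L).comap (Config.realizeHom μ)

theorem mem_sliceConfigs {L : ℕ} {μ : Marking} {c : Config L} :
    c ∈ sliceConfigs L μ ↔ c.realize μ ∈ sliceGroup L := Iff.rfl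

theorem firstLaw_of_mem_sliceConfigs {L : ℕ} (hodd : Odd L) (hL : 3 ≤ L) {μ : Marking}
    {c : Config L} (hc : c ∈ sliceConfigs L μ) : c.FirstLaw := by
  obtain ⟨d, hd, h⟩ := exists_config_of_mem_sliceGroup hodd hL μ hc
  rwa [← Config.realizeHom_injective μ h]

theorem sliceConfig_mem {L : ℕ} (hodd : Odd L) (hL : 3 ≤ L) (μ : Marking) (b : Fin 3) {c : ℤ}
    (hc : c ≠ 0) : sliceConfig μ b c ∈ sliceConfigs L μ := by
  rw [mem_sliceConfigs, realize_sliceConfig hodd hL μ b hc]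
  exact slice_mem_sliceGroup b hc

/-- The configurations in which all cubelets outside of the subsystem `X` are solved. -/
def localConfigs {L : ℕ} (X : Subsystem L) : Subgroup (Config L) where
  carrier := {c | ∀ Y, Y ≠ X → c.perm Y = 1 ∧ c.ori Y = 0}
  one_mem' _ _ := ⟨rfl, rfl⟩
  mul_mem' {c d} hc hd Y hY := by
    obtain ⟨h1, h2⟩ := hc Y hY
    obtain ⟨h3, h4⟩ := hd Y hY
    refine ⟨by rw [Config.mul_perm, h1, h3, mul_one], ?_⟩
    funext p
    simp [Config.mul_ori, h2, h4]
  inv_mem' {c} hc Y hY := by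
    obtain ⟨h1, h2⟩ := hc Y hY
    refine ⟨by rw [Config.inv_perm, h1, inv_one], ?_⟩
    funext p
    simp [Config.inv_ori, h2]

/-- The cubelet permutation in the subsystem `X`, as a group homomorphism. -/
def permHom {L : ℕ} (X : Subsystem L) : Config L →* Perm X.Cubelet where
  toFun c := c.perm X
  map_one' := rfl
  map_mul' _ _ := rfl

/-- The permutations of the cubelets of `X` that slice-rotations realize without changing
anything else. -/
noncomputable def localPerms {L : ℕ} (μ : Marking) (X : Subsystem L) : Subgroup (Perm X.Cubelet) :=
  (sliceConfigs L μ ⊓ localConfigs X).map (permHom X)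

/-- A commutator of two permutations whose supports meet in one cubelet. -/
theorem exists_threeCycle_of_commutator {L : ℕ} (hodd : Odd L) (hL : 3 ≤ L) (μ : Marking)
    {s u : Perm (Facelet L)} {s' u' : Perm Vec} (hs : ∀ f, (s f).pos = s' f.pos)
    (hu : ∀ f, (u f).pos = u' f.pos) (hmem : s * u * s⁻¹ * u⁻¹ ∈ sliceGroup L)
    {X : Subsystem L} {P : Vec} (hP : X.Mem P) (hsP : X.Mem (s' P)) (huP : X.Mem (u' P))
    (hD : ∀ p, s' p ≠ p → u' p ≠ p → p = P) (hDf : ∀ f, s f ≠ f → u f ≠ f → f.pos = P)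
    (h1 : s' P ≠ P) (h2 : u' P ≠ P) :
    ∃ π ∈ localPerms μ X, π.IsThreeCycle ∧ π ⟨P, hP⟩ = ⟨s' P, hsP⟩ ∧ π ⟨u' P, huP⟩ = ⟨P, hP⟩ := by
  obtain ⟨c, hc, hcg⟩ := exists_config_of_mem_sliceGroup hodd hL μ hmem
  have inv_pos : ∀ (g : Perm (Facelet L)) (g' : Perm Vec), (∀ f, (g f).pos = g' f.pos) →
      ∀ f, (g⁻¹ f).pos = g'⁻¹ f.pos := by
    intro g g' h f
    rw [Perm.eq_inv_iff_eq, ← h]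
    simp
  have hpos : ∀ (Y : Subsystem L) (q : Y.Cubelet),
      (c.perm Y q).1 = (s' * u' * s'⁻¹ * u'⁻¹) q.1 := by
    intro Y q
    have := congrArg Facelet.pos (Config.realize_faceletAt μ c Y q 0)
    rw [hcg] at this
    simp only [Perm.mul_apply, hs, hu, inv_pos s s' hs, inv_pos u u' hu] at this ⊢
    exact this.symm
  obtain ⟨k1, k2, k3⟩ := commutator_apply_of_moved hD h1 h2
  have hsu : s' P ≠ u' P := by
    intro h
    rw [← h, k2, ← h] at k3
    exact h1 k3
  have e1 : c.perm X ⟨P, hP⟩ = ⟨s' P, hsP⟩ := Subtype.ext ((hpos _ _).trans k1)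
  have e2 : c.perm X ⟨s' P, hsP⟩ = ⟨u' P, huP⟩ := Subtype.ext ((hpos _ _).trans k2)
  have e3 : c.perm X ⟨u' P, huP⟩ = ⟨P, hP⟩ := Subtype.ext ((hpos _ _).trans k3)
  -- Nothing is claimed about the orientations that `c` gives to the cubelets of `X` itself.
  refine ⟨c.perm X, ⟨c, ⟨?_, ?_⟩, rfl⟩, ?_, e1, e3⟩
  · change c.realize μ ∈ sliceGroup L
    rwa [hcg]
  · intro Y hY
    have key : ∀ (q : Y.Cubelet) (t : ZMod Y.modulus),
        c.perm Y q = q ∧ t + c.ori Y q = t := by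
      intro q t
      have hne : ∀ v, X.Mem v → q.1 ≠ v := fun v hv h => hY ((h ▸ q.2 : Y.Mem v).unique hv)
      -- `P`, `s' P` and `u' P` are positions of `X`, so no facelet of another subsystem is near the
      -- common support, and even its orientation is kept.
      have hfix := commutator_apply_of_not_moved (s := s) (u := u) (D := {f | f.pos = P})
        (fun f h h' => hDf f h h') (x := faceletAt μ ⟨Y, q, t⟩) (hne P hP)
        (fun f hf h => hne _ hsP (by rw [← hf, ← hs, h]; rfl))
        (fun f hf h => hne _ huP (by rw [← hf, ← hu, h]; rfl))
      rw [← hcg, Config.realize_faceletAt] at hfix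
      have := (faceletAt μ).injective hfix
      simpa using this
    exact ⟨Equiv.ext fun q => (key q 0).1, funext fun q => by simpa using (key q 0).2⟩
  · refine isThreeCycle_of_apply (a := ⟨P, hP⟩) (b := ⟨s' P, hsP⟩) (c := ⟨u' P, huP⟩) ?_ ?_ ?_
      e1 e2 e3 ?_
    · simpa using h1.symm
    · simpa using h2.symm
    · simpa using hsu
    · intro q q1 q2 q3
      ext1
      rw [hpos]
      refine commutator_apply_of_not_moved (D := {P}) (fun p h h' => hD p h h') ?_ ?_ ?_
      · exact fun h => q1 (Subtype.ext h)
      · rintro _ rfl h; exact q2 (Subtype.ext h.symm)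
      · rintro _ rfl h; exact q3 (Subtype.ext h.symm)

theorem turn_ne_self {b : Fin 3} {p : Vec} (h : ¬(p (b + 1) = 0 ∧ p (b + 2) = 0)) :
    turn b p ≠ p := by
  intro e
  have h1 := congrFun e (b + 1)
  have h2 := congrFun e (b + 2)
  rw [turn_add_one] at h1
  rw [turn_add_two] at h2
  omega

/-- The commutator of a slice with a conjugate, by a permutation `F` of a layer that contains `P`,
of a parallel slice. -/
theorem exists_threeCycle_of_layer {L : ℕ} (hodd : Odd L) (hL : 3 ≤ L) (μ : Marking)
    {X : Subsystem L} {P : Vec} (hP : X.Mem P) {b b' b'' : Fin 3}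
    (haxes : ∀ P : Fin 3 → Prop, P b → P b' → P b'' → ∀ a, P a)
    (hbb' : b' = b + 1 ∨ b' = b + 2)
    (hP' : P b' ≠ 0) {F : Perm (Facelet L)} {φ : Perm Vec} (hF : F ∈ sliceGroup L)
    (hFφ : ∀ f, (F f).pos = φ f.pos) (hφX : ∀ p, X.Mem p → X.Mem (φ p) ∧ X.Mem (φ⁻¹ p))
    (hφ : ∀ p, p b' ≠ P b' → φ⁻¹ p = p) (ε : ℤˣ)
    (hφ' : ∀ p, p b' = P b' → (φ⁻¹ p) b' = P b' ∧ (φ⁻¹ p) b = ε * p b'')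
    (h0 : (ε : ℤ) * P b'' ≠ 0) (hne : (ε : ℤ) * P b'' ≠ P b) :
    ∃ π ∈ localPerms μ X, π.IsThreeCycle ∧ π ⟨P, hP⟩ = ⟨turn b P, hP.turn b⟩ ∧
      π ⟨φ (turn b (φ⁻¹ P)), (hφX _ ((hφX P hP).2.turn b)).1⟩ = ⟨P, hP⟩ := by
  set d : ℤ := ε * P b'' with hd
  have moved : ∀ (c : ℤ) (f : Facelet L), slice L b c f ≠ f → f.pos b = c := fun c f h => by
    by_contra h'
    exact h (slice_apply_of_ne h')
  have moved' : ∀ (c : ℤ) (p : Vec), slicePos b c p ≠ p → p b = c := fun c p h => by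
    by_contra h'
    exact h (by rw [slicePos_apply, if_neg h'])
  -- A point moved by both factors is in layer `P b`, and `φ⁻¹` brings it into the different layer
  -- `d`. So `φ⁻¹` moves it, which fixes its coordinate `b'`, and `d` determines its coordinate
  -- `b''`.
  have unique : ∀ p, p b = P b → (φ⁻¹ p) b = d → p = P := by
    intro p h1 h2
    have h3 : p b' = P b' := by
      by_contra h3
      rw [hφ p h3, h1] at h2
      exact hne h2.symm
    have h4 : (ε : ℤ) * p b'' = ε * P b'' := (hφ' p h3).2.symm.trans h2
    have h5 : p b'' = P b'' := mul_left_cancel₀ (Units.ne_zero ε) h4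
    exact funext (haxes _ h1 h3 h5)
  have conj_ne : ∀ {α : Type} (g t : Perm α) (x : α), (g * t * g⁻¹) x ≠ x → t (g⁻¹ x) ≠ g⁻¹ x := by
    intro α g t x h h'
    apply h
    rw [Perm.mul_apply, Perm.mul_apply, h']
    simp
  have inv_pos : ∀ f, (F⁻¹ f).pos = φ⁻¹ f.pos := by
    intro f
    rw [Perm.eq_inv_iff_eq, ← hFφ]
    simp
  have hsP : slicePos b (P b) P = turn b P := by rw [slicePos_apply, if_pos rfl]
  obtain ⟨q1, q2⟩ := hφ' P rfl
  have huP : (φ * slicePos b d * φ⁻¹) P = φ (turn b (φ⁻¹ P)) := by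
    rw [Perm.mul_apply, Perm.mul_apply, slicePos_apply, if_pos q2]
  have key := exists_threeCycle_of_commutator hodd hL μ (s := slice L b (P b))
    (u := F * slice L b d * F⁻¹) (s' := slicePos b (P b)) (u' := φ * slicePos b d * φ⁻¹)
    (fun f => slice_pos b _ f)
    (fun f => by simp only [Perm.mul_apply, hFφ, slice_pos, inv_pos])
    -- The layer `P b` may be a middle one; only the layer `d` inside the conjugate must not be.
    (slice_commutator_mem b _ (mul_mem (mul_mem hF (slice_mem_sliceGroup b h0)) (inv_mem hF)))
    hP (by rw [hsP]; exact hP.turn b) (by rw [huP]; exact (hφX _ ((hφX P hP).2.turn b)).1)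
    (fun p h1 h2 => unique p (moved' _ p h1) (moved' _ _ (conj_ne _ _ _ h2)))
    (fun f h1 h2 => unique _ (moved _ f h1) (by
      rw [← inv_pos]; exact moved _ _ (conj_ne _ _ _ h2)))
    (by
      rw [hsP]
      refine turn_ne_self ?_
      rcases hbb' with rfl | rfl <;> tauto)
    (by
      rw [huP]
      intro h
      rw [← Perm.eq_inv_iff_eq] at h
      refine turn_ne_self ?_ h
      rw [← q1] at hP'
      rcases hbb' with rfl | rfl <;> tauto)
  simp only [hsP, huP] at key
  exact key

/-! ### Connectedness of the subsystems -/

/-- Two cubelets of a subsystem are linked if a chain of local 3-cycles leads from one to the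
other. -/
def Linked {L : ℕ} (μ : Marking) (X : Subsystem L) : X.Cubelet → X.Cubelet → Prop :=
  Relation.EqvGen fun p q => ∃ π ∈ localPerms μ X, π.IsThreeCycle ∧ π p = q

theorem slicePos_inv_of_eq {b : Fin 3} {c : ℤ} {p : Vec} (h : p b = c) :
    (slicePos b c)⁻¹ p = turnInv b p := by
  rw [slicePos_inv_apply, if_pos h]

theorem slicePos_of_eq {b : Fin 3} {c : ℤ} {p : Vec} (h : p b = c) :
    slicePos b c p = turn b p := by
  rw [slicePos_apply, if_pos h]

theorem Subsystem.mem_slicePos_inv {L : ℕ} (X : Subsystem L) (b : Fin 3) (c : ℤ) (p : Vec)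
    (hp : X.Mem p) : X.Mem ((slicePos b c)⁻¹ p) := by
  rw [← X.mem_slicePos b c, Perm.coe_inv, apply_symm_apply]
  exact hp

/-- The four basic local 3-cycles. -/
theorem exists_threeCycle_add_two {L : ℕ} (hodd : Odd L) (hL : 3 ≤ L) (μ : Marking)
    {X : Subsystem L} {P : Vec} (hP : X.Mem P) (b : Fin 3) (h1 : P (b + 1) ≠ 0)
    (h2 : P (b + 2) ≠ 0) (hne : P (b + 1) ≠ P b) :
    ∃ (q : X.Cubelet), ∃ π ∈ localPerms μ X, π.IsThreeCycle ∧
      π ⟨P, hP⟩ = ⟨turn b P, hP.turn b⟩ ∧ π q = ⟨P, hP⟩ ∧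
      (P b = 0 → q.1 = turn b (turnInv (b + 2) P)) := by
  obtain ⟨e1, e2, e3, e4⟩ := axis_add b
  have t1 := turnInv_add_one (b + 2)
  have t2 := turnInv_add_two (b + 2)
  simp only [e3, e4] at t1 t2
  obtain ⟨π, k1, k2, k3, k4⟩ := exists_threeCycle_of_layer hodd hL μ hP (b := b) (b' := b + 2)
    (b'' := b + 1) (fun Q q0 q2 q1 => (forall_axis b Q).2 ⟨q0, q1, q2⟩) (.inr rfl) h2
    (slice_mem_sliceGroup (b + 2) h2) (fun f => slice_pos _ _ f)
    (fun p hp => ⟨(X.mem_slicePos _ _ p).2 hp, X.mem_slicePos_inv _ _ p hp⟩)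
    (fun p hp => by rw [slicePos_inv_apply, if_neg hp]) 1
    (fun p hp => by
      rw [slicePos_inv_of_eq hp, turnInv_at, t1]
      exact ⟨hp, by simp⟩) (by simpa using h1) (by simpa using hne)
  refine ⟨_, π, k1, k2, k3, k4, fun h0 => ?_⟩
  change slicePos _ _ _ = _
  -- If `P b = 0`, the turn about `b` takes the point out of the conjugating layer, so the last
  -- slice does not act on it.
  rw [slicePos_inv_of_eq rfl, slicePos_apply, if_neg]
  rw [turn_add_two, t2, h0, neg_zero]
  exact h2.symm

theorem exists_threeCycle_add_one {L : ℕ} (hodd : Odd L) (hL : 3 ≤ L) (μ : Marking)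
    {X : Subsystem L} {P : Vec} (hP : X.Mem P) (b : Fin 3) (h1 : P (b + 1) ≠ 0)
    (h2 : P (b + 2) ≠ 0) (hne : P (b + 2) ≠ P b) :
    ∃ (q : X.Cubelet), ∃ π ∈ localPerms μ X, π.IsThreeCycle ∧
      π ⟨P, hP⟩ = ⟨turn b P, hP.turn b⟩ ∧ π q = ⟨P, hP⟩ ∧
      (P b = 0 → q.1 = turn b (turn (b + 1) P)) := by
  obtain ⟨e1, e2, e3, e4⟩ := axis_add b
  have t1 := turn_add_one (b + 1)
  have t2 := turn_add_two (b + 1)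
  simp only [e1, e2] at t1 t2
  obtain ⟨π, k1, k2, k3, k4⟩ := exists_threeCycle_of_layer hodd hL μ hP (b := b) (b' := b + 1)
    (b'' := b + 2) (fun Q q0 q1 q2 => (forall_axis b Q).2 ⟨q0, q1, q2⟩) (.inl rfl) h1
    (inv_mem (slice_mem_sliceGroup (b + 1) h1)) (fun f => slice_inv_pos _ _ f)
    (fun p hp => ⟨X.mem_slicePos_inv _ _ p hp, by
      rw [inv_inv]; exact (X.mem_slicePos _ _ p).2 hp⟩)
    (fun p hp => by rw [inv_inv, slicePos_apply, if_neg hp]) 1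
    (fun p hp => by
      rw [inv_inv, slicePos_of_eq hp, turn_at, t2]
      exact ⟨hp, by simp⟩) (by simpa using h2) (by simpa using hne)
  refine ⟨_, π, k1, k2, k3, k4, fun h0 => ?_⟩
  change (slicePos _ _)⁻¹ (turn b ((slicePos _ _)⁻¹⁻¹ P)) = _
  rw [inv_inv, slicePos_of_eq rfl, slicePos_inv_apply, if_neg]
  rw [turn_add_one, t1, h0, neg_zero, neg_zero]
  exact h1.symm

/-- Conjugating in the opposite direction uses the layer `-P (b + 1)`, which helps when the layer `P
(b + 1)` coincides with the layer `P b`. -/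
theorem exists_threeCycle_neg {L : ℕ} (hodd : Odd L) (hL : 3 ≤ L) (μ : Marking)
    {X : Subsystem L} {P : Vec} (hP : X.Mem P) (b : Fin 3) (h1 : P (b + 1) ≠ 0)
    (h2 : P (b + 2) ≠ 0) (hne : -P (b + 1) ≠ P b) :
    ∃ π ∈ localPerms μ X, π.IsThreeCycle ∧ π ⟨P, hP⟩ = ⟨turn b P, hP.turn b⟩ := by
  obtain ⟨e1, e2, e3, e4⟩ := axis_add b
  have t1 := turn_add_one (b + 2)
  simp only [e3, e4] at t1
  obtain ⟨π, k1, k2, k3, -⟩ := exists_threeCycle_of_layer hodd hL μ hP (b := b) (b' := b + 2)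
    (b'' := b + 1) (fun Q q0 q2 q1 => (forall_axis b Q).2 ⟨q0, q1, q2⟩) (.inr rfl) h2
    (inv_mem (slice_mem_sliceGroup (b + 2) h2)) (fun f => slice_inv_pos _ _ f)
    (fun p hp => ⟨X.mem_slicePos_inv _ _ p hp, by
      rw [inv_inv]; exact (X.mem_slicePos _ _ p).2 hp⟩)
    (fun p hp => by rw [inv_inv, slicePos_apply, if_neg hp]) (-1)
    (fun p hp => by
      rw [inv_inv, slicePos_of_eq hp, turn_at, t1]
      exact ⟨hp, by simp⟩) (by simpa using h1) (by simpa using hne)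
  exact ⟨π, k1, k2, k3⟩

theorem linked_turn_of_ne_zero {L : ℕ} (hodd : Odd L) (hL : 3 ≤ L) (μ : Marking)
    {X : Subsystem L} {P : Vec} (hP : X.Mem P) (b : Fin 3) (h1 : P (b + 1) ≠ 0)
    (h2 : P (b + 2) ≠ 0) : Linked μ X ⟨P, hP⟩ ⟨turn b P, hP.turn b⟩ := by
  by_cases hne : P (b + 1) = P b
  · obtain ⟨π, k1, k2, k3⟩ := exists_threeCycle_neg hodd hL μ hP b h1 h2 (by omega)
    exact .rel _ _ ⟨π, k1, k2, k3⟩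
  · obtain ⟨q, π, k1, k2, k3, -⟩ := exists_threeCycle_add_two hodd hL μ hP b h1 h2 hne
    exact .rel _ _ ⟨π, k1, k2, k3⟩

/-- Two vanishing coordinates would make `p` a face centre or an interior point. -/
theorem Subsystem.Mem.eq_zero_cases {L : ℕ} {X : Subsystem L} {p : Vec} (h : X.Mem p)
    (hr : 0 < rad L) (b : Fin 3) (h0 : p b = 0) : p (b + 1) ≠ 0 ∧ p (b + 2) ≠ 0 := by
  rw [Subsystem.mem_iff b] at h
  rw [← abs_pos, ← abs_pos]
  simp only [h0, abs_zero] at h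
  cases X <;> simp only at h <;> omega

/-- Every cubelet is linked to its images under the rotations of space. -/
theorem linked_turn {L : ℕ} (hodd : Odd L) (hL : 3 ≤ L) (μ : Marking)
    {X : Subsystem L} {P : Vec} (hP : X.Mem P) (b : Fin 3) :
    Linked μ X ⟨P, hP⟩ ⟨turn b P, hP.turn b⟩ := by
  have hr : 0 < rad L := by rw [rad_eq hodd hL]; omega
  obtain ⟨e1, e2, e3, e4⟩ := axis_add b
  -- The direct 3-cycle conjugates by slices at nonzero coordinates. If `P (b + 2) = 0`, a 3-cycle
  -- about `b + 2` links `P` to its preimage `q` instead, and `turn (b + 1) q` is the desired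
  -- position `turn b P`.
  by_cases h2 : P (b + 2) = 0
  · obtain ⟨h0, h1⟩ := hP.eq_zero_cases hr (b + 2) h2
    rw [e3] at h0
    rw [e4] at h1
    obtain ⟨q, π, k1, k2, -, k4, k5⟩ := exists_threeCycle_add_two hodd hL μ hP (b + 2)
      (by rwa [e3]) (by rwa [e4]) (by rw [e3, h2]; exact h0)
    have k6 := k5 h2
    rw [e4] at k6
    have t1 := turnInv_add_one (b + 1) P
    have t2 := turnInv_add_two (b + 1) P
    have t3 := fun p => turn_add_one (b + 2) p
    have t4 := fun p => turn_add_two (b + 2) p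
    have t5 := fun p => turn_add_one (b + 1) p
    have t6 := fun p => turn_add_two (b + 1) p
    simp only [e1, e2, e3, e4] at t1 t2 t3 t4 t5 t6
    have q0 : q.1 b = -P (b + 1) := by rw [k6, t3, turnInv_at]
    have q1 : q.1 (b + 1) = 0 := by rw [k6, t4, t2, h2, neg_zero]
    have q2 : q.1 (b + 2) = P b := by rw [k6, turn_at, t1]
    have link := linked_turn_of_ne_zero hodd hL μ q.2 (b + 1)
      (by rw [e1, q2]; exact h0) (by rw [e2, q0]; exact neg_ne_zero.2 h1)
    have same : turn (b + 1) q.1 = turn b P := by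
      refine vec_ext b ?_ ?_ ?_
      · rw [t6, q2, turn_at]
      · rw [turn_at, q1, turn_add_one, h2, neg_zero]
      · rw [t5, q0, turn_add_two, neg_neg]
    simp only [same] at link
    exact .trans _ _ _ (.symm _ _ (.rel _ _ ⟨π, k1, k2, k4⟩)) link
  -- Here the preimage `q` of `P` under a 3-cycle about `b + 1` equals `turn (b + 2) (turn b P)`.
  by_cases h1 : P (b + 1) = 0
  · obtain ⟨h3, h0⟩ := hP.eq_zero_cases hr (b + 1) h1
    rw [e2] at h0
    obtain ⟨q, π, k1, k2, -, k4, k5⟩ := exists_threeCycle_add_one hodd hL μ hP (b + 1)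
      (by rwa [e1]) (by rwa [e2]) (by rw [e2, h1]; exact h0)
    have k6 := k5 h1
    rw [e1] at k6
    have t3 := fun p => turn_add_one (b + 2) p
    have t4 := fun p => turn_add_two (b + 2) p
    have t5 := fun p => turn_add_one (b + 1) p
    have t6 := fun p => turn_add_two (b + 1) p
    simp only [e1, e2, e3, e4] at t3 t4 t5 t6
    have link := linked_turn_of_ne_zero hodd hL μ (hP.turn b) (b + 2)
      (by rw [e3, turn_at]; exact h0) (by rw [e4, turn_add_one]; exact neg_ne_zero.2 h2)
    have same : turn (b + 2) (turn b P) = q.1 := by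
      rw [k6]
      refine vec_ext b ?_ ?_ ?_ <;>
        simp only [t3, t4, t5, t6, turn_at, turn_add_one, turn_add_two, h1, neg_neg, neg_zero]
    simp only [same] at link
    exact .trans _ _ _ (.symm _ _ (.rel _ _ ⟨π, k1, k2, k4⟩)) (.symm _ _ link)
  · exact linked_turn_of_ne_zero hodd hL μ hP b h1 h2

/-! ### Rotations of space act transitively on every subsystem -/

/-- `q` is the image of `p` under a rotation of space. -/
def Rotated : Vec → Vec → Prop := Relation.ReflTransGen fun p q => ∃ b, q = turn b p

theorem rotated_turn (b : Fin 3) (p : Vec) : Rotated p (turn b p) := .single ⟨b, rfl⟩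

theorem rotated_half (b : Fin 3) (p : Vec) :
    Rotated p (fun a => if a = b then p a else -p a) := by
  have : turn b (turn b p) = fun a => if a = b then p a else -p a := by
    funext a
    fin_cases b <;> fin_cases a <;> simp [turn]
  rw [← this]
  exact (rotated_turn b p).trans (rotated_turn b _)

theorem rotated_cyclic (p : Vec) : Rotated p (fun a => p (a + 2)) := by
  have : turn 2 (turn 0 p) = fun a => p (a + 2) := by
    funext a
    fin_cases a <;> simp [turn]
  rw [← this]
  exact (rotated_turn 0 p).trans (rotated_turn 2 _)

theorem rotated_shift (a : Fin 3) (p : Vec) : Rotated p (fun i => p (i + a)) := by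
  have h := rotated_cyclic
  fin_cases a
  · simp only [Fin.zero_eta, add_zero]; exact .refl
  · have := (h p).trans (h _)
    simp only [add_assoc] at this
    exact this
  · exact h p

/-- If `chir p ≥ 0`, the number of negative coordinates is even, or a zero coordinate absorbs one
sign change. A half turn, or nothing at all, then makes all signs nonnegative. -/
theorem rotated_abs {p : Vec} (hp : 0 ≤ chir p) : Rotated p (fun a => |p a|) := by
  have flip : ∀ b, (∀ a, (if a = b then p a else -p a) = |p a|) → Rotated p (fun a => |p a|) := by
    intro b h
    have := rotated_half b p
    rwa [funext h] at this
  have keep : (∀ a, p a = |p a|) → Rotated p (fun a => |p a|) := by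
    intro h
    rw [← funext h]
    exact .refl
  have cases3 : ∀ x y z : ℤ, 0 ≤ x * y * z → (x = |x| ∧ y = |y| ∧ z = |z|) ∨
      (x = |x| ∧ -y = |y| ∧ -z = |z|) ∨ (-x = |x| ∧ y = |y| ∧ -z = |z|) ∨
      (-x = |x| ∧ -y = |y| ∧ z = |z|) := by
    intro x y z h
    have zero : x * y * z ≤ 0 → x = 0 ∨ y = 0 ∨ z = 0 := by
      intro h'
      have := le_antisymm h' h
      rw [mul_eq_zero, mul_eq_zero] at this
      tauto
    have sgn : ∀ w : ℤ, (0 ≤ w ∧ |w| = w) ∨ (w ≤ 0 ∧ |w| = -w) := fun w =>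
      (le_total 0 w).imp (fun h => ⟨h, abs_of_nonneg h⟩) fun h => ⟨h, abs_of_nonpos h⟩
    rcases sgn x with ⟨hx, ax⟩ | ⟨hx, ax⟩ <;> rcases sgn y with ⟨hy, ay⟩ | ⟨hy, ay⟩ <;>
      rcases sgn z with ⟨hz, az⟩ | ⟨hz, az⟩ <;> rw [ax, ay, az]
    · simp
    · have := zero (mul_nonpos_of_nonneg_of_nonpos (mul_nonneg hx hy) hz)
      rcases this with rfl | rfl | rfl <;> simp
    · have := zero (mul_nonpos_of_nonpos_of_nonneg (mul_nonpos_of_nonneg_of_nonpos hx hy) hz)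
      rcases this with rfl | rfl | rfl <;> simp
    · simp
    · have := zero (mul_nonpos_of_nonpos_of_nonneg (mul_nonpos_of_nonpos_of_nonneg hx hy) hz)
      rcases this with rfl | rfl | rfl <;> simp
    · simp
    · simp
    · have := zero (mul_nonpos_of_nonneg_of_nonpos (mul_nonneg_of_nonpos_of_nonpos hx hy) hz)
      rcases this with rfl | rfl | rfl <;> simp
  rcases cases3 _ _ _ hp with ⟨h0, h1, h2⟩ | ⟨h0, h1, h2⟩ | ⟨h0, h1, h2⟩ | ⟨h0, h1, h2⟩
  · exact keep (by simpa [Fin.forall_fin_succ] using ⟨h0, h1, h2⟩)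
  · exact flip 0 (by simpa [Fin.forall_fin_succ] using ⟨h0, h1, h2⟩)
  · exact flip 1 (by simpa [Fin.forall_fin_succ] using ⟨h0, h1, h2⟩)
  · exact flip 2 (by simpa [Fin.forall_fin_succ] using ⟨h0, h1, h2⟩)

theorem rotated_of_abs_eq {p v : Vec} (hp : 0 ≤ chir p) (h : ∀ a, |p a| = v a) : Rotated p v := by
  have := rotated_abs hp
  rwa [funext h] at this

/-- A representative position of every subsystem. -/
def Subsystem.base {L : ℕ} : Subsystem L → Vec
  | .corner => ![rad L, rad L, rad L]
  | .edge => ![0, rad L, rad L]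
  | .wing k => ![(k : ℕ) + 1, rad L, rad L]
  | .plus k => ![(k : ℕ) + 1, 0, rad L]
  | .center i j => ![(i : ℕ) + 1, (j : ℕ) + 1, rad L]

theorem shift_index (a : Fin 3) : 0 + (a + 1) = a + 1 ∧ 1 + (a + 1) = a + 2 ∧ 2 + (a + 1) = a := by
  decide +revert

theorem Subsystem.Mem.rotated_base {L : ℕ} {X : Subsystem L} {p : Vec} (h : X.Mem p) :
    Rotated p X.base := by
  -- For corners and edges a quarter turn about axis 0 repairs a negative `chir` without changing
  -- the absolute values.
  have mirror : ∀ (q v : Vec), (∀ a, |q a| = v a) → (∀ a, |RubikCube.turn 0 q a| = v a) → Rotated q v := by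
    intro q v h1 h2
    rcases le_total 0 (chir q) with h | h
    · exact rotated_of_abs_eq h h1
    · exact (rotated_turn 0 q).trans (rotated_of_abs_eq (by rw [chir_turn]; omega) h2)
  -- For centre pieces a quarter turn about axis 2 exchanges the two distances, exactly as
  -- membership with negative `chir` requires.
  have mirror' : ∀ (q v : Vec), (0 ≤ chir q → ∀ a, |q a| = v a) →
      (chir q < 0 → ∀ a, |RubikCube.turn 2 q a| = v a) → Rotated q v := by
    intro q v h1 h2
    rcases le_or_gt 0 (chir q) with h | h
    · exact rotated_of_abs_eq h (h1 h)
    · exact (rotated_turn 2 q).trans (rotated_of_abs_eq (by rw [chir_turn]; omega) (h2 h))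
  cases X with
  | corner =>
    refine mirror _ _ ?_ ?_
    · have := h
      simp only [Subsystem.Mem, Fin.forall_fin_succ] at this
      simpa [Subsystem.base, Fin.forall_fin_succ] using this
    · have := h.turn 0
      simp only [Subsystem.Mem, Fin.forall_fin_succ] at this
      simpa [Subsystem.base, Fin.forall_fin_succ] using this
  | edge =>
    obtain ⟨a, h0, h1, h2, -⟩ := h
    refine (rotated_shift a p).trans (mirror _ _ ?_ ?_) <;>
      simp [Subsystem.base, Fin.forall_fin_succ, RubikCube.turn, h0, add_comm _ a, h1, h2]
  | wing k =>
    obtain ⟨a, h0, h1, h2⟩ := h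
    refine (rotated_shift a p).trans (mirror _ _ ?_ ?_) <;>
      simp [Subsystem.base, Fin.forall_fin_succ, RubikCube.turn, h0, add_comm _ a, h1, h2]
  | plus k =>
    obtain ⟨a, h0, h1⟩ := h
    have shift := (rotated_shift (a + 1) p)
    have e : (fun i => p (i + (a + 1))) 0 = p (a + 1) ∧ (fun i => p (i + (a + 1))) 1 = p (a + 2) ∧
        (fun i => p (i + (a + 1))) 2 = p a := by
      obtain ⟨i0, i1, i2⟩ := shift_index a
      exact ⟨congrArg p i0, congrArg p i1, congrArg p i2⟩
    obtain ⟨e0, e1, e2⟩ := e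
    generalize (fun i => p (i + (a + 1))) = q at *
    rw [← e0, ← e1] at h1
    rw [← e2] at h0
    refine shift.trans ?_
    rcases h1 with ⟨h1, h2⟩ | ⟨h1, h2⟩
    · refine rotated_of_abs_eq ?_ ?_
      · simp [chir, h2]
      · simp [Subsystem.base, Fin.forall_fin_succ, h0, h1, h2]
    · refine (rotated_turn 2 q).trans (rotated_of_abs_eq ?_ ?_)
      · rw [chir_turn]; simp [chir, h1]
      · simp [Subsystem.base, Fin.forall_fin_succ, RubikCube.turn, h0, h1, h2]
  | center i j =>
    obtain ⟨a, h0, h1⟩ := h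
    have shift := (rotated_shift (a + 1) p)
    have e : (fun i => p (i + (a + 1))) 0 = p (a + 1) ∧ (fun i => p (i + (a + 1))) 1 = p (a + 2) ∧
        (fun i => p (i + (a + 1))) 2 = p a := by
      obtain ⟨i0, i1, i2⟩ := shift_index a
      exact ⟨congrArg p i0, congrArg p i1, congrArg p i2⟩
    obtain ⟨e0, e1, e2⟩ := e
    generalize (fun i => p (i + (a + 1))) = q at *
    have hc : chir p = chir q := by rw [chir_eq a p, chir, e0, e1, e2]; ring
    rw [← e0, ← e1, hc] at h1
    rw [← e2] at h0
    refine shift.trans (mirror' _ _ ?_ ?_)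
    · intro hq
      rcases h1 with ⟨h1, h2, h3⟩ | ⟨h1, -, -⟩
      · simp [Subsystem.base, Fin.forall_fin_succ, h0, h2, h3]
      · omega
    · intro hq
      rcases h1 with ⟨h1, -, -⟩ | ⟨h1, h2, h3⟩
      · omega
      · simp [Subsystem.base, Fin.forall_fin_succ, RubikCube.turn, h0, h2, h3]

theorem linked_of_rotated {L : ℕ} (hodd : Odd L) (hL : 3 ≤ L) (μ : Marking) {X : Subsystem L}
    {p q : Vec} (h : Rotated p q) (hp : X.Mem p) :
    ∃ hq : X.Mem q, Linked μ X ⟨p, hp⟩ ⟨q, hq⟩ := by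
  change Relation.ReflTransGen _ p q at h
  induction h with
  | refl => exact ⟨hp, .refl _⟩
  | tail _ h ih =>
    obtain ⟨b, rfl⟩ := h
    obtain ⟨hq, h'⟩ := ih
    exact ⟨hq.turn b, .trans _ _ _ h' (linked_turn hodd hL μ hq b)⟩

theorem Subsystem.mem_base {L : ℕ} (hr : 0 < rad L) (X : Subsystem L) : X.Mem X.base := by
  cases X with
  | corner => simp [Subsystem.Mem, Subsystem.base, Fin.forall_fin_succ, hr.le]
  | edge => exact ⟨0, by simp [Subsystem.base, hr.le, hr]⟩
  | wing k => exact ⟨0, by simp [Subsystem.base, hr.le]; omega⟩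
  | plus k => exact ⟨2, by simp [Subsystem.base, hr.le]; omega⟩
  | center i j =>
    refine ⟨2, by simp [Subsystem.base, hr.le], .inl ⟨?_, ?_, ?_⟩⟩
    · simp only [chir, Subsystem.base]
      simp
      positivity
    · simp [Subsystem.base]; omega
    · simp [Subsystem.base]; omega

/-- Slice-rotations realize every even permutation of the cubelets of one subsystem. -/
theorem alternatingGroup_le_localPerms {L : ℕ} (hodd : Odd L) (hL : 3 ≤ L) (μ : Marking)
    (X : Subsystem L) : alternatingGroup X.Cubelet ≤ localPerms μ X := by
  have hr : 0 < rad L := by rw [rad_eq hodd hL]; omega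
  have : Nontrivial X.Cubelet := by
    refine ⟨⟨X.base, X.mem_base hr⟩, ⟨turn 0 X.base, (X.mem_base hr).turn 0⟩, ?_⟩
    intro h
    refine turn_ne_self (b := 0) (p := X.base) ?_ (congrArg Subtype.val h).symm
    rintro ⟨-, h2⟩
    cases X <;> simp [Subsystem.base] at h2 <;> omega
  refine alternatingGroup_le_of_connected _ fun p q => ?_
  obtain ⟨hp, h1⟩ := linked_of_rotated hodd hL μ p.2.rotated_base p.2
  obtain ⟨hq, h2⟩ := linked_of_rotated hodd hL μ q.2.rotated_base q.2
  exact .trans _ _ _ h1 (.symm _ _ h2)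

/-! ### Opposite twists -/

/-- A group of orientation vectors that is stable under 3-cycles and contains a non-constant vector
contains all opposite twists. -/
theorem single_sub_single_mem {ι : Type*} [Fintype ι] [DecidableEq ι] {m : ℕ}
    (V : AddSubgroup (ι → ZMod m))
    (hV : ∀ σ : Perm ι, σ.IsThreeCycle → ∀ v ∈ V, v ∘ σ ∈ V)
    (hm : ∀ y : ZMod m, y ≠ 0 → y = 1 ∨ y = -1) (hcard : 5 ≤ Fintype.card ι) {v : ι → ZMod m}
    (hv : v ∈ V) {p s : ι} (hps : v p ≠ v s) (x y : ι) :
    Pi.single x 1 - Pi.single y 1 ∈ V := by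
  have avoid : ∀ T : Finset ι, T.card < 5 → ∃ x, x ∉ T := by
    intro T hT
    by_contra! h
    have : T = Finset.univ := Finset.eq_univ_of_forall h
    rw [this, Finset.card_univ] at hT
    omega
  have key : ∀ p s : ι, v p ≠ v s → ∀ a, a ≠ p → a ≠ s → Pi.single s 1 - Pi.single a 1 ∈ V := by
    intro p s hps a hap has
    have hps' : p ≠ s := fun h => hps (by rw [h])
    obtain ⟨t, ht⟩ := avoid {p, s, a} (lt_of_le_of_lt Finset.card_le_three (by omega))
    obtain ⟨b, hb⟩ := avoid {p, s, a, t} (lt_of_le_of_lt Finset.card_le_four (by omega))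
    simp only [Finset.mem_insert, Finset.mem_singleton, not_or] at ht hb
    obtain ⟨ht1, ht2, ht3⟩ := ht
    obtain ⟨hb1, hb2, hb3, hb4⟩ := hb
    have hσ := Perm.isThreeCycle_swap_mul_swap_same (Ne.symm ht2) hps'.symm ht1
    have hτ := Perm.isThreeCycle_swap_mul_swap_same has.symm (Ne.symm hb2) (Ne.symm hb3)
    set σ := swap s t * swap s p with hσ_def
    set τ := swap s a * swap s b with hτ_def
    have σs : σ s = p := by simp [hσ_def, swap_apply_of_ne_of_ne hps' (Ne.symm ht1)]
    have σx : ∀ x, x ≠ s → x ≠ p → x ≠ t → σ x = x := by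
      intro x h1 h2 h3
      simp [hσ_def, swap_apply_of_ne_of_ne, h1, h2, h3]
    have τs : τ s = b := by simp [hτ_def, swap_apply_of_ne_of_ne hb2 hb3]
    have τa : τ a = s := by
      simp [hτ_def, swap_apply_of_ne_of_ne has (Ne.symm hb3)]
    have τb : τ b = a := by simp [hτ_def]
    have τx : ∀ x, x ≠ s → x ≠ a → x ≠ b → τ x = x := by
      intro x h1 h2 h3
      simp [hτ_def, swap_apply_of_ne_of_ne, h1, h2, h3]
    have hw := sub_mem hv (hV σ hσ v hv)
    -- The difference is supported on the 3-cycle `s, p, t` and is nonzero at `s`. A second 3-cycle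
    -- `s, b, a` meets this support only in `s`, so the next difference lives on `s` and `a` alone.
    -- This is where five points are needed.
    set w := v - v ∘ σ with hw_def
    have ws : w s = v s - v p := by simp [hw_def, σs]
    have wx : ∀ x, x ≠ s → x ≠ p → x ≠ t → w x = 0 := by
      intro x h1 h2 h3
      simp [hw_def, σx x h1 h2 h3]
    have hu := sub_mem hw (hV τ hτ w hw)
    have wa := wx a has hap (Ne.symm ht3)
    have wb := wx b hb2 hb1 hb4
    have : w - w ∘ τ = w s • (Pi.single s 1 - Pi.single a 1 : ι → ZMod m) := by
      funext x
      by_cases h1 : x = s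
      · subst h1; simp [τs, wb, has.symm]
      by_cases h2 : x = a
      · subst h2; simp [τa, wa, has]
      by_cases h3 : x = b
      · subst h3; simp [τb, wa, wb, hb2, hb3]
      · simp [τx x h1 h2 h3, h1, h2]
    rw [this] at hu
    -- The coefficient is `1` or `-1`, so it can be divided out.
    rcases hm (w s) (by rw [ws]; exact sub_ne_zero.2 hps.symm) with h | h
    · rwa [h, one_smul] at hu
    · rw [h, neg_smul, one_smul] at hu
      exact neg_mem_iff.1 hu
  obtain ⟨c, hc⟩ := avoid {p, s} (lt_of_le_of_lt Finset.card_le_two (by omega))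
  simp only [Finset.mem_insert, Finset.mem_singleton, not_or] at hc
  have hsc := key p s hps c hc.1 hc.2
  have hpc := key s p hps.symm c hc.2 hc.1
  have all : ∀ x, Pi.single x 1 - Pi.single c 1 ∈ V := by
    intro x
    by_cases h1 : x = p
    · subst h1; exact hpc
    by_cases h2 : x = s
    · subst h2; exact hsc
    have := sub_mem hsc (key p s hps x h1 h2)
    rwa [sub_sub_sub_cancel_left] at this
  have := sub_mem (all x) (all y)
  rwa [sub_sub_sub_cancel_right] at this

/-- The orientations of the cubelets of `X` that slice-rotations realize without changing
anything else. -/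
noncomputable def localOris {L : ℕ} (μ : Marking) (X : Subsystem L) :
    AddSubgroup (X.Cubelet → ZMod X.modulus) where
  carrier := {v | ∃ c ∈ sliceConfigs L μ ⊓ localConfigs X, c.perm X = 1 ∧ c.ori X = v}
  zero_mem' := ⟨1, one_mem _, rfl, rfl⟩
  add_mem' := by
    rintro v w ⟨c, hc, hc1, rfl⟩ ⟨d, hd, hd1, rfl⟩
    refine ⟨c * d, mul_mem hc hd, by rw [Config.mul_perm, hc1, hd1, mul_one], ?_⟩
    funext p
    simp [Config.mul_ori, hd1, add_comm]
  neg_mem' := by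
    rintro v ⟨c, hc, hc1, rfl⟩
    refine ⟨c⁻¹, inv_mem hc, by rw [Config.inv_perm, hc1, inv_one], ?_⟩
    funext p
    simp [Config.inv_ori, hc1]

theorem exists_config_of_sign_eq_one {L : ℕ} (hodd : Odd L) (hL : 3 ≤ L) (μ : Marking)
    {X : Subsystem L} {π : Perm X.Cubelet} (hπ : Perm.sign π = 1) :
    ∃ c ∈ sliceConfigs L μ ⊓ localConfigs X, c.perm X = π :=
  alternatingGroup_le_localPerms hodd hL μ X (Perm.mem_alternatingGroup.2 hπ)

/-- Conjugation by a local configuration with permutation `σ` relabels the twists; its own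
orientations cancel, because `c` keeps all positions. -/
theorem comp_mem_localOris {L : ℕ} (hodd : Odd L) (hL : 3 ≤ L) (μ : Marking) {X : Subsystem L}
    (σ : Perm X.Cubelet) (hσ : σ.IsThreeCycle) (v : X.Cubelet → ZMod X.modulus)
    (hv : v ∈ localOris μ X) : v ∘ σ ∈ localOris μ X := by
  obtain ⟨a, ha, rfl⟩ := exists_config_of_sign_eq_one hodd hL μ hσ.sign
  obtain ⟨c, hc, hc1, rfl⟩ := hv
  refine ⟨a⁻¹ * (c * a), mul_mem (inv_mem ha) (mul_mem hc ha), ?_, ?_⟩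
  · rw [Config.mul_perm, Config.mul_perm, Config.inv_perm, hc1, one_mul, inv_mul_cancel]
  · funext p
    simp [Config.mul_ori, Config.mul_perm, Config.inv_ori, hc1]

theorem localConfigs_conj {L : ℕ} {X : Subsystem L} {a : Config L} (ha : a ∈ localConfigs X)
    (g : Config L) : g * a * g⁻¹ ∈ localConfigs X := by
  intro Y hY
  obtain ⟨h1, h2⟩ := ha Y hY
  refine ⟨by rw [Config.mul_perm, Config.mul_perm, Config.inv_perm, h1, mul_one, mul_inv_cancel],
    ?_⟩
  funext p
  simp [Config.mul_ori, Config.inv_ori, Config.inv_perm, h1, h2]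

/-- A configuration that twists one cubelet in place and fixes two others yields a non-constant
orientation vector. -/
theorem exists_mem_localOris_ne {L : ℕ} (hodd : Odd L) (hL : 3 ≤ L) (μ : Marking) {X : Subsystem L}
    {g : Config L} (hg : g ∈ sliceConfigs L μ) {p q s : X.Cubelet} (hpq : p ≠ q) (hps : p ≠ s)
    (hqs : q ≠ s) (gp : g.perm X p = p) (gq : g.perm X q = q) (gs : g.perm X s = s)
    (op : g.ori X p ≠ 0) (oq : g.ori X q = 0) (os : g.ori X s = 0) :
    ∃ v ∈ localOris μ X, v p ≠ v s := by
  have h3 := Perm.isThreeCycle_swap_mul_swap_same (a := p) hps hpq hqs.symm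
  obtain ⟨a, ha, hπ⟩ := exists_config_of_sign_eq_one hodd hL μ h3.sign
  have ap : a.perm X p = q := by simp [hπ, swap_apply_of_ne_of_ne hpq.symm hqs]
  have aq : a.perm X q = s := by simp [hπ]
  have as : a.perm X s = p := by simp [hπ, swap_apply_of_ne_of_ne hps.symm hqs.symm]
  have ax : ∀ x, x ≠ p → x ≠ q → x ≠ s → a.perm X x = x := by
    intro x h1 h2 h4
    simp [hπ, swap_apply_of_ne_of_ne, h1, h2, h4]
  -- `g` fixes the three points that `a` permutes, so the commutator of `g` and `a` keeps all
  -- positions.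
  have comm : g.perm X * a.perm X = a.perm X * g.perm X := by
    ext1 x
    simp only [Perm.mul_apply]
    by_cases h1 : x = p
    · rw [h1, ap, gq, gp, ap]
    by_cases h2 : x = q
    · rw [h2, aq, gs, gq, aq]
    by_cases h4 : x = s
    · rw [h4, as, gp, gs, as]
    rw [ax x h1 h2 h4, ax (g.perm X x)]
    · exact fun h => h1 ((g.perm X).injective (h.trans gp.symm))
    · exact fun h => h2 ((g.perm X).injective (h.trans gq.symm))
    · exact fun h => h4 ((g.perm X).injective (h.trans gs.symm))
  have inv_eq : ∀ (π : Perm X.Cubelet) (x y : X.Cubelet), π x = y → π⁻¹ y = x := by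
    rintro π x _ rfl; simp
  refine ⟨(g * a * g⁻¹ * a⁻¹).ori X, ⟨g * a * g⁻¹ * a⁻¹, ⟨?_, ?_⟩, ?_, rfl⟩, ?_⟩
  · let W := sliceConfigs L μ
    exact W.mul_mem (W.mul_mem (W.mul_mem hg ha.1) (W.inv_mem hg)) (W.inv_mem ha.1)
  · exact (localConfigs X).mul_mem (localConfigs_conj ha.2 g) ((localConfigs X).inv_mem ha.2)
  · simp only [Config.mul_perm, Config.inv_perm, comm]
    group
  -- The orientations of `a` cancel: the commutator has the twist of `g` at `p` and none at `s`.
  · simp only [Config.mul_ori, Config.inv_ori, Config.inv_perm,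
      inv_eq _ _ _ aq, inv_eq _ _ _ as, inv_eq _ _ _ gq, inv_eq _ _ _ gs, aq, as, oq, os]
    simpa using op

/-- Two turns about different axes carry a corner away and back. Its total twist is independent of
the marking and nonzero, while corners away from both layers stay fixed. -/
theorem exists_corner_twist {L : ℕ} (hodd : Odd L) (hL : 3 ≤ L) (μ : Marking) :
    ∃ v ∈ localOris μ (Subsystem.corner : Subsystem L), ∃ p s, v p ≠ v s := by
  have hr : 0 < rad L := by rw [rad_eq hodd hL]; omega
  have mem : ∀ x y z : ℤ, |x| = rad L → |y| = rad L → |z| = rad L →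
      (Subsystem.corner : Subsystem L).Mem ![x, y, z] := by
    intro x y z hx hy hz
    simp [Subsystem.Mem, Fin.forall_fin_succ, hx, hy, hz]
  set r := rad L with hrad
  have r1 : |r| = r := abs_of_pos hr
  have r2 : |-r| = r := by rw [abs_neg, r1]
  have rne : r ≠ -r := by omega
  have rne' : -r ≠ r := by omega
  let p : (Subsystem.corner : Subsystem L).Cubelet := ⟨![r, r, -r], mem _ _ _ r1 r1 r2⟩
  let p' : (Subsystem.corner : Subsystem L).Cubelet := ⟨![r, r, r], mem _ _ _ r1 r1 r1⟩
  let q : (Subsystem.corner : Subsystem L).Cubelet := ⟨![-r, -r, r], mem _ _ _ r2 r2 r1⟩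
  let s : (Subsystem.corner : Subsystem L).Cubelet := ⟨![-r, -r, -r], mem _ _ _ r2 r2 r2⟩
  let A : Config L := sliceConfig μ 0 r
  let B : Config L := sliceConfig μ 1 r
  have Ap : A.perm .corner p = p' := by
    ext a
    change slicePos 0 r ![r, r, -r] a = ![r, r, r] a
    fin_cases a <;> simp [slicePos_apply, turn]
  have Bp : B.perm .corner p' = p := by
    ext a
    change slicePos 1 r ![r, r, r] a = ![r, r, -r] a
    fin_cases a <;> simp [slicePos_apply, turn]
  have Aq : A.perm .corner q = q := by
    ext a
    change slicePos 0 r ![-r, -r, r] a = ![-r, -r, r] a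
    simp [slicePos_apply, rne']
  have Bq : B.perm .corner q = q := by
    ext a
    change slicePos 1 r ![-r, -r, r] a = ![-r, -r, r] a
    simp [slicePos_apply, rne']
  have As : A.perm .corner s = s := by
    ext a
    change slicePos 0 r ![-r, -r, -r] a = ![-r, -r, -r] a
    simp [slicePos_apply, rne']
  have Bs : B.perm .corner s = s := by
    ext a
    change slicePos 1 r ![-r, -r, -r] a = ![-r, -r, -r] a
    simp [slicePos_apply, rne']
  have ori : ∀ (b : Fin 3) (x y : (Subsystem.corner : Subsystem L).Cubelet),
      (sliceConfig μ b r : Config L).perm .corner x = y →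
      (sliceConfig μ b r : Config L).ori .corner x =
        potential μ b .corner x.1 - potential μ b .corner y.1 := by
    rintro b x _ rfl; rfl
  have cp : ¬0 < chir ![r, r, -r] := by
    have : 0 < r * r * r := by positivity
    simp [chir]
    omega
  have cp' : 0 < chir ![r, r, r] := by
    simp [chir]
    positivity
  obtain ⟨v, hv, h⟩ := exists_mem_localOris_ne hodd hL μ (g := B * A) (p := p) (q := q) (s := s)
    (mul_mem (sliceConfig_mem hodd hL μ 1 hr.ne') (sliceConfig_mem hodd hL μ 0 hr.ne'))
    (fun h => rne (congrFun (congrArg Subtype.val h) 0))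
    (fun h => rne (congrFun (congrArg Subtype.val h) 0))
    (fun h => rne (congrFun (congrArg Subtype.val h) 2))
    (by rw [Config.mul_perm, Perm.mul_apply, Ap, Bp])
    (by rw [Config.mul_perm, Perm.mul_apply, Aq, Bq])
    (by rw [Config.mul_perm, Perm.mul_apply, As, Bs])
    (by
      rw [Config.mul_ori, Ap, ori 0 _ _ Ap, ori 1 _ _ Bp]
      simp only [potential, p, p', if_neg cp, if_pos cp']
      have : ∀ m m' : Fin 3, (0 - m) - (m' - 0) + ((m' - 1) - (1 - m)) ≠ 0 := by decide
      exact this _ _)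
    (by rw [Config.mul_ori, Aq, ori 0 _ _ Aq, ori 1 _ _ Bq, sub_self, sub_self, add_zero])
    (by rw [Config.mul_ori, As, ori 0 _ _ As, ori 1 _ _ Bs, sub_self, sub_self, add_zero])
  exact ⟨v, hv, p, s, h⟩

/-- Turns about the three axes lead an edge around a corner of the cube back to its place. Apart
from marking terms, which cancel, each turn contributes `1`, so the edge is flipped. -/
theorem exists_edge_twist {L : ℕ} (hodd : Odd L) (hL : 3 ≤ L) (μ : Marking) :
    ∃ v ∈ localOris μ (Subsystem.edge : Subsystem L), ∃ p s, v p ≠ v s := by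
  have hr : 0 < rad L := by rw [rad_eq hodd hL]; omega
  have mem : ∀ (a : Fin 3) (w : Vec), w a = 0 → |w (a + 1)| = rad L → |w (a + 2)| = rad L →
      (Subsystem.edge : Subsystem L).Mem w := fun a w h0 h1 h2 => ⟨a, h0, h1, h2, hr⟩
  set r := rad L with hrad
  have r1 : |r| = r := abs_of_pos hr
  have r2 : |-r| = r := by rw [abs_neg, r1]
  have rne' : -r ≠ r := by omega
  have rne0 : r ≠ 0 := by omega
  have rne0' : 0 ≠ r := by omega
  let p : (Subsystem.edge : Subsystem L).Cubelet := ⟨![r, r, 0], mem 2 _ rfl r1 r1⟩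
  let p₁ : (Subsystem.edge : Subsystem L).Cubelet := ⟨![r, 0, r], mem 1 _ rfl r1 r1⟩
  let p₂ : (Subsystem.edge : Subsystem L).Cubelet := ⟨![0, r, r], mem 0 _ rfl r1 r1⟩
  let q : (Subsystem.edge : Subsystem L).Cubelet := ⟨![-r, -r, 0], mem 2 _ rfl r2 r2⟩
  let s : (Subsystem.edge : Subsystem L).Cubelet := ⟨![-r, 0, -r], mem 1 _ rfl r2 r2⟩
  let A : Config L := sliceConfig μ 0 r
  let B : Config L := sliceConfig μ 2 r
  let C : Config L := sliceConfig μ 1 r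
  have Ap : A.perm .edge p = p₁ := by
    ext a
    change slicePos 0 r ![r, r, 0] a = ![r, 0, r] a
    fin_cases a <;> simp [slicePos_apply, turn]
  have Bp : B.perm .edge p₁ = p₂ := by
    ext a
    change slicePos 2 r ![r, 0, r] a = ![0, r, r] a
    fin_cases a <;> simp [slicePos_apply, turn]
  have Cp : C.perm .edge p₂ = p := by
    ext a
    change slicePos 1 r ![0, r, r] a = ![r, r, 0] a
    fin_cases a <;> simp [slicePos_apply, turn]
  have fix : ∀ b, (sliceConfig μ b r : Config L).perm .edge q = q ∧
      (sliceConfig μ b r : Config L).perm .edge s = s := by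
    intro b
    constructor
    · ext a
      change slicePos b r ![-r, -r, 0] a = ![-r, -r, 0] a
      rw [slicePos_apply, if_neg]
      fin_cases b <;> simp [rne', rne0']
    · ext a
      change slicePos b r ![-r, 0, -r] a = ![-r, 0, -r] a
      rw [slicePos_apply, if_neg]
      fin_cases b <;> simp [rne', rne0']
  have ori : ∀ (b : Fin 3) (x y : (Subsystem.edge : Subsystem L).Cubelet),
      (sliceConfig μ b r : Config L).perm .edge x = y →
      (sliceConfig μ b r : Config L).ori .edge x =
        potential μ b .edge x.1 - potential μ b .edge y.1 := by
    rintro b x _ rfl; rfl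
  have i0 : innerAxis L ![r, r, 0] = 2 :=
    innerAxis_eq (a := 2) (by simpa using rne0') r1 r1
  have i1 : innerAxis L ![r, 0, r] = 1 :=
    innerAxis_eq (a := 1) (by simpa using rne0') r1 r1
  have i2 : innerAxis L ![0, r, r] = 0 :=
    innerAxis_eq (a := 0) (by simpa using rne0') r1 r1
  have rne : r ≠ -r := rne'.symm
  obtain ⟨v, hv, h⟩ := exists_mem_localOris_ne hodd hL μ (g := C * (B * A)) (p := p) (q := q)
    (s := s)
    (mul_mem (sliceConfig_mem hodd hL μ 1 hr.ne') (mul_mem (sliceConfig_mem hodd hL μ 2 hr.ne')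
      (sliceConfig_mem hodd hL μ 0 hr.ne')))
    (fun h => rne (congrFun (congrArg Subtype.val h) 0))
    (fun h => rne (congrFun (congrArg Subtype.val h) 0))
    (fun h => rne0 (neg_eq_zero.1 (congrFun (congrArg Subtype.val h) 1)))
    (by rw [Config.mul_perm, Config.mul_perm, Perm.mul_apply, Perm.mul_apply, Ap, Bp, Cp])
    (by
      rw [Config.mul_perm, Config.mul_perm, Perm.mul_apply, Perm.mul_apply, (fix 0).1, (fix 2).1,
        (fix 1).1])
    (by
      rw [Config.mul_perm, Config.mul_perm, Perm.mul_apply, Perm.mul_apply, (fix 0).2, (fix 2).2,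
        (fix 1).2])
    (by
      rw [Config.mul_ori, Config.mul_ori, Config.mul_perm, Perm.mul_apply, Ap, Bp, ori 0 _ _ Ap,
        ori 2 _ _ Bp, ori 1 _ _ Cp]
      simp only [potential, p, p₁, p₂, i0, i1, i2]
      have : ∀ m m₁ m₂ : ZMod 2,
          ((m + if (2 : Fin 3) = 0 + 1 then 1 else 0) -
            (m₁ + if (1 : Fin 3) = 0 + 1 then 1 else 0)) +
          ((m₁ + if (1 : Fin 3) = 2 + 1 then 1 else 0) -
            (m₂ + if (0 : Fin 3) = 2 + 1 then 1 else 0)) +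
          ((m₂ + if (0 : Fin 3) = 1 + 1 then 1 else 0) -
            (m + if (2 : Fin 3) = 1 + 1 then 1 else 0)) ≠ 0 := by decide
      exact this _ _ _)
    (by
      rw [Config.mul_ori, Config.mul_ori, Config.mul_perm, Perm.mul_apply, (fix 0).1, (fix 2).1,
        ori 0 _ _ (fix 0).1, ori 2 _ _ (fix 2).1, ori 1 _ _ (fix 1).1]
      simp only [sub_self, add_zero])
    (by
      rw [Config.mul_ori, Config.mul_ori, Config.mul_perm, Perm.mul_apply, (fix 0).2, (fix 2).2,
        ori 0 _ _ (fix 0).2, ori 2 _ _ (fix 2).2, ori 1 _ _ (fix 1).2]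
      simp only [sub_self, add_zero])
  exact ⟨v, hv, p, s, h⟩

theorem five_le_card {L : ℕ} (hr : 0 < rad L) {X : Subsystem L} (hX : X = .corner ∨ X = .edge) :
    5 ≤ Fintype.card X.Cubelet := by
  have make : ∀ f : Fin 5 → Vec, (∀ i, X.Mem (f i)) → Function.Injective f →
      5 ≤ Fintype.card X.Cubelet := by
    intro f h hf
    have := Fintype.card_le_of_injective (fun i => (⟨f i, h i⟩ : X.Cubelet))
      (fun i j hij => hf (congrArg Subtype.val hij))
    simpa using this
  set r := rad L with hrad
  have r1 : |r| = r := abs_of_pos hr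
  have rne : r ≠ -r := by omega
  have rne' : -r ≠ r := by omega
  have rne0 : r ≠ 0 := by omega
  rcases hX with rfl | rfl
  · refine make ![![r, r, r], ![r, r, -r], ![r, -r, r], ![r, -r, -r], ![-r, r, r]] ?_ ?_
    · intro i a
      fin_cases i <;> fin_cases a <;> simp [r1, ← hrad]
    · intro i j h
      fin_cases i <;> fin_cases j <;> simp [rne, rne'] at h ⊢
  · refine make ![![0, r, r], ![0, r, -r], ![0, -r, r], ![0, -r, -r], ![r, 0, r]] ?_ ?_
    · intro i
      fin_cases i
      · exact ⟨0, by simp [r1, ← hrad, hr]⟩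
      · exact ⟨0, by simp [r1, ← hrad, hr]⟩
      · exact ⟨0, by simp [r1, ← hrad, hr]⟩
      · exact ⟨0, by simp [r1, ← hrad, hr]⟩
      · exact ⟨1, by simp [r1, ← hrad, hr]⟩
    · intro i j h
      fin_cases i <;> fin_cases j <;> simp [rne, rne', rne0, rne0.symm] at h ⊢

theorem Config.IsOppositeTwist.mem_sliceConfigs {L : ℕ} (hodd : Odd L) (hL : 3 ≤ L) (μ : Marking)
    {c : Config L} (hc : c.IsOppositeTwist) : c ∈ sliceConfigs L μ := by
  have hr : 0 < rad L := by rw [rad_eq hodd hL]; omega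
  obtain ⟨h0, X, hX, ⟨p, q, hpq, h1⟩, h2⟩ := hc
  have key : c.ori X ∈ localOris μ X := by
    rw [h1]
    have hcard := five_le_card hr hX
    rcases hX with rfl | rfl
    · obtain ⟨v, hv, x, y, hxy⟩ := exists_corner_twist hodd hL μ
      refine single_sub_single_mem (ι := (Subsystem.corner : Subsystem L).Cubelet) _
        (comp_mem_localOris hodd hL μ) ?_ hcard hv hxy p q
      change ∀ y : ZMod 3, y ≠ 0 → y = 1 ∨ y = -1
      decide
    · obtain ⟨v, hv, x, y, hxy⟩ := exists_edge_twist hodd hL μ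
      refine single_sub_single_mem (ι := (Subsystem.edge : Subsystem L).Cubelet) _
        (comp_mem_localOris hodd hL μ) ?_ hcard hv hxy p q
      change ∀ y : ZMod 2, y ≠ 0 → y = 1 ∨ y = -1
      decide
  obtain ⟨d, hd, hd1, hd2⟩ := key
  have : c = d := by
    refine Config.ext (funext fun Y => ?_) (funext fun Y => ?_)
    · by_cases hY : Y = X
      · subst hY; rw [h0, hd1]; rfl
      · rw [h0, (hd.2 Y hY).1]; rfl
    · by_cases hY : Y = X
      · subst hY; rw [hd2]
      · rw [h2 Y hY, (hd.2 Y hY).2]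
  rw [this]
  exact hd.1

/-- A local configuration with the right permutation may have wrong orientations. The First Law
holds for both, so the quotient is a product of opposite twists; on wings it is trivial. -/
theorem Config.IsThreeCycle.mem_sliceConfigs {L : ℕ} (hodd : Odd L) (hL : 3 ≤ L) (μ : Marking)
    {c : Config L} (hc : c.IsThreeCycle) : c ∈ sliceConfigs L μ := by
  have hF := hc.firstLaw
  obtain ⟨-, X, h1, h2⟩ := hc
  obtain ⟨d, hd, hd1⟩ := exists_config_of_sign_eq_one hodd hL μ h1.sign
  have key : c * d⁻¹ ∈ sliceConfigs L μ := by
    refine Config.mem_of_oppositeTwists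
      (fun e he => Config.IsOppositeTwist.mem_sliceConfigs hodd hL μ he) ?_ ?_
    · exact (Config.firstLaw L).mul_mem hF
        ((Config.firstLaw L).inv_mem (firstLaw_of_mem_sliceConfigs hodd hL hd.1))
    · funext Y
      rw [Config.mul_perm, Config.inv_perm]
      by_cases hY : Y = X
      · subst hY; rw [hd1, mul_inv_cancel]; rfl
      · rw [h2 Y hY, (hd.2 Y hY).1, inv_one, mul_one]; rfl
  have := mul_mem key hd.1
  rwa [inv_mul_cancel_right] at this

/-! ### The First Law is sufficient -/

/-- The signs of corners and wings are the only free ones. -/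
theorem Config.FirstLaw.sgn_eq {L : ℕ} {c d : Config L} (hc : c.FirstLaw) (hd : d.FirstLaw)
    (h1 : c.sgn .corner = d.sgn .corner) (h2 : ∀ k, c.sgn (.wing k) = d.sgn (.wing k))
    (X : Subsystem L) : c.sgn X = d.sgn X := by
  cases X with
  | corner => exact h1
  | edge => rw [← hc.sgn_edge, ← hd.sgn_edge, h1]
  | wing k => exact h2 k
  | plus k => rw [hc.sgn_plus, hd.sgn_plus, h1, h2]
  | center i j =>
    by_cases hij : i = j
    · subst hij; rw [← hc.sgn_xCenter, ← hd.sgn_xCenter, h1]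
    · rw [hc.sgn_oblique i j hij, hd.sgn_oblique i j hij, h1, h2, h2]

/-- An outer turn changes the corner sign and no wing sign; a turn of the layer with index `l`
changes the sign of `wing l` and neither the corner sign nor any other wing sign. -/
theorem exists_sliceConfig_sgn {L : ℕ} (hodd : Odd L) (hL : 3 ≤ L) (μ : Marking) (ε : ℤˣ)
    (δ : Fin ((L - 3) / 2) → ℤˣ) :
    ∃ g ∈ sliceConfigs L μ, g.sgn .corner = ε ∧ ∀ k, g.sgn (.wing k) = δ k := by
  have hr : 0 < rad L := by rw [rad_eq hodd hL]; omega
  have key : ∀ T : Finset (Fin ((L - 3) / 2)), ∃ g ∈ sliceConfigs L μ, g.sgn .corner = ε ∧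
      ∀ k, g.sgn (.wing k) = if k ∈ T then δ k else 1 := by
    intro T
    induction T using Finset.induction_on with
    | empty =>
      rcases Int.units_eq_one_or ε with rfl | rfl
      · exact ⟨1, one_mem _, Config.sgn_one _, fun k => by simp [Config.sgn_one]⟩
      · refine ⟨sliceConfig μ 0 (rad L), sliceConfig_mem hodd hL μ 0 hr.ne', ?_, fun k => ?_⟩
        · rw [sgn_sliceConfig hr μ 0 hr.ne']
          simp [quarterCount, abs_of_pos hr]
        · have hk := index_lt k
          rw [sgn_sliceConfig hr μ 0 hr.ne']
          simp [quarterCount, abs_of_pos hr, hk.ne']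
    | insert l T hl ih =>
      obtain ⟨g, hg, h1, h2⟩ := ih
      rcases Int.units_eq_one_or (δ l) with hδ | hδ
      · refine ⟨g, hg, h1, fun k => ?_⟩
        rw [h2]
        by_cases hk : k = l
        · subst hk; simp [hδ]
        · simp [hk]
      · have hl0 : ((l : ℕ) : ℤ) + 1 ≠ 0 := by omega
        have hl1 : |((l : ℕ) : ℤ) + 1| = (l : ℕ) + 1 := abs_of_nonneg (by omega)
        have hlr := index_lt l
        refine ⟨sliceConfig μ 0 ((l : ℕ) + 1) * g, mul_mem (sliceConfig_mem hodd hL μ 0 hl0) hg,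
          ?_, fun k => ?_⟩
        · rw [Config.sgn_mul, h1, sgn_sliceConfig hr μ 0 hl0]
          simp [quarterCount, hl1, hlr.ne]
        · rw [Config.sgn_mul, h2, sgn_sliceConfig hr μ 0 hl0]
          by_cases hk : k = l
          · subst hk
            simp [quarterCount, hl1, hlr.ne, hl, hδ]
          · have hk' : (l : ℕ) ≠ k := fun h => hk (Fin.ext h.symm)
            simp [quarterCount, hl1, hlr.ne, hk, hk']
  obtain ⟨g, hg, h1, h2⟩ := key Finset.univ
  exact ⟨g, hg, h1, fun k => by simpa using h2 k⟩

/-- After division by a product of slices with the same signs, only 3-cycles and opposite twists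
remain to be realized. -/
theorem Config.FirstLaw.mem_sliceConfigs {L : ℕ} (hodd : Odd L) (hL : 3 ≤ L) (μ : Marking)
    {c : Config L} (hc : c.FirstLaw) : c ∈ sliceConfigs L μ := by
  obtain ⟨g, hg, hg1, hg2⟩ := exists_sliceConfig_sgn hodd hL μ (c.sgn .corner)
    fun k => c.sgn (.wing k)
  have hgF := firstLaw_of_mem_sliceConfigs hodd hL hg
  have hd : (c * g⁻¹).FirstLaw := (Config.firstLaw L).mul_mem hc ((Config.firstLaw L).inv_mem hgF)
  have hs : ∀ X, (c * g⁻¹).sgn X = 1 := by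
    intro X
    rw [Config.sgn_mul, Config.sgn_inv, hgF.sgn_eq hc hg1 hg2, Int.units_mul_self]
  obtain ⟨c₁, c₂, h1, h2, -, h3, h4⟩ := hd.three_steps
  -- A coupled 2-cycle has the sign `-1` somewhere, but all signs are `1` here.
  have hc₁ : c₁ = 1 := by
    refine h1.resolve_right ?_
    rintro ⟨-, -, S, ⟨X, hX⟩, h5, -⟩
    have h6 := (h2 X).trans (hs X)
    rw [Config.sgn, (h5 X hX).sign_eq] at h6
    exact absurd h6 (by decide)
  have k1 := h3 (sliceConfigs L μ) fun d hd => hd.mem_sliceConfigs hodd hL μ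
  have k2 := h4 (sliceConfigs L μ) fun d hd => hd.mem_sliceConfigs hodd hL μ
  rw [hc₁, inv_one, mul_one] at k1
  have := mul_mem (mul_mem k2 k1) hg
  rwa [inv_mul_cancel_right, inv_mul_cancel_right] at this

end RubikCube

open RubikCube in
/-- Let `L ≥ 3` be odd, and fix any convention `μ` for measuring orientations. -/
theorem mainTheorem1 (L : ℕ) (hodd : Odd L) (hL : 3 ≤ L) (μ : Marking) :
    -- swap-moves and slice-rotations generate the same group
    Subgroup.closure (swapMoves L μ) = sliceGroup L ∧
    -- and reach the same colourings, from the solved cube and from any other initial colouring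
    reachable (swapMoves L μ) (solved L) = reachable (sliceRotations L) (solved L) ∧
    (∀ s : Colouring L, reachable (swapMoves L μ) s = reachable (sliceRotations L) s) ∧
    -- swap-moves respect the constraints
    (∀ c : Config L, c.IsThreeCycle ∨ c.IsOppositeTwist ∨ c.IsCoupledTwoCycle → c.FirstLaw) ∧
    -- slice-rotations act by cubelet permutations and orientations, and the constraints are
    -- necessary and sufficient for reachability by slice-rotations
    (∀ g ∈ sliceGroup L, ∃! c : Config L, c.realize μ = g) ∧
    (∀ c : Config L, c.realize μ ∈ sliceGroup L ↔ c.FirstLaw) ∧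
    -- every configuration that satisfies the constraints is built in three steps
    (∀ c : Config L, c.FirstLaw →
      ∃ c₁ c₂ : Config L, ∃ g₁ g₂ g₃ : Equiv.Perm (Facelet L),
        (g₁ = 1 ∨ g₁ ∈ coupledTwoCycles L μ) ∧
        g₂ ∈ Subgroup.closure (threeCycles L μ) ∧
        g₃ ∈ Subgroup.closure (oppositeTwists L μ) ∧
        c₁.realize μ = g₁ ∧ (∀ X, c₁.sgn X = c.sgn X) ∧
        c₂.realize μ = g₂ * g₁ ∧ c₂.perm = c.perm ∧
        c.realize μ = g₃ * g₂ * g₁) := by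
  have hlaw : ∀ c : Config L, c.IsThreeCycle ∨ c.IsOppositeTwist ∨ c.IsCoupledTwoCycle →
      c.FirstLaw := by
    rintro c (hc | hc | hc)
    · exact hc.firstLaw
    · exact hc.firstLaw
    · exact hc.2.1
  have hsteps : ∀ c : Config L, c.FirstLaw →
      ∃ c₁ c₂ : Config L, ∃ g₁ g₂ g₃ : Equiv.Perm (Facelet L),
        (g₁ = 1 ∨ g₁ ∈ coupledTwoCycles L μ) ∧
        g₂ ∈ Subgroup.closure (threeCycles L μ) ∧
        g₃ ∈ Subgroup.closure (oppositeTwists L μ) ∧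
        c₁.realize μ = g₁ ∧ (∀ X, c₁.sgn X = c.sgn X) ∧
        c₂.realize μ = g₂ * g₁ ∧ c₂.perm = c.perm ∧
        c.realize μ = g₃ * g₂ * g₁ := by
    intro c hc
    obtain ⟨c₁, c₂, h1, h2, h3, h4, h5⟩ := hc.three_steps
    refine ⟨c₁, c₂, Config.realizeHom μ c₁, Config.realizeHom μ (c₂ * c₁⁻¹),
      Config.realizeHom μ (c * c₂⁻¹), ?_, ?_, ?_, rfl, h2, ?_, h3, ?_⟩
    · exact h1.imp (fun h => by rw [h, map_one]) fun h => ⟨c₁, h, rfl⟩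
    -- The arbitrary subgroup `W` is taken to be the preimage of the group that the facelet moves
    -- generate.
    · exact h4 ((Subgroup.closure (threeCycles L μ)).comap (Config.realizeHom μ))
        fun d hd => Subgroup.subset_closure ⟨d, hd, rfl⟩
    · exact h5 ((Subgroup.closure (oppositeTwists L μ)).comap (Config.realizeHom μ))
        fun d hd => Subgroup.subset_closure ⟨d, hd, rfl⟩
    · rw [← map_mul, inv_mul_cancel_right]; rfl
    · rw [← map_mul, ← map_mul]
      exact congrArg (Config.realizeHom μ) (by group)
  have hiff : ∀ c : Config L, c.realize μ ∈ sliceGroup L ↔ c.FirstLaw := fun c =>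
    ⟨fun h => firstLaw_of_mem_sliceConfigs hodd hL h, fun h => h.mem_sliceConfigs hodd hL μ⟩
  have hgroup : Subgroup.closure (swapMoves L μ) = sliceGroup L := by
    refine le_antisymm ((Subgroup.closure_le _).2 ?_) ?_
    · intro g hg
      obtain ⟨c, hc, rfl⟩ := mem_swapMoves.1 hg
      exact (hiff c).2 (hlaw c hc)
    · intro g hg
      obtain ⟨c, hc, rfl⟩ := exists_config_of_mem_sliceGroup hodd hL μ hg
      obtain ⟨c₁, c₂, g₁, g₂, g₃, h1, h2, h3, -, -, -, -, h4⟩ := hsteps c hc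
      rw [h4]
      refine mul_mem (mul_mem ?_ ?_) ?_
      · exact Subgroup.closure_mono (fun x hx => .inl (.inr hx)) h3
      · exact Subgroup.closure_mono (fun x hx => .inl (.inl hx)) h2
      · rcases h1 with rfl | h1
        · exact one_mem _
        · exact Subgroup.subset_closure (.inr h1)
  have hreach : ∀ s : Colouring L,
      reachable (swapMoves L μ) s = reachable (sliceRotations L) s := by
    intro s
    rw [reachable_eq (fun g hg => inv_mem_swapMoves hg),
      reachable_eq (fun g hg => inv_mem_sliceRotations hg), hgroup]
    rfl
  refine ⟨hgroup, hreach _, hreach, hlaw, ?_, hiff, hsteps⟩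
  intro g hg
  obtain ⟨c, -, rfl⟩ := exists_config_of_mem_sliceGroup hodd hL μ hg
  exact ⟨c, rfl, fun d hd => Config.realizeHom_injective μ hd⟩
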